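/- Let $Q$ be a countably infinite set. For $A\subseteq Q$ let $\mathcal C_A$ be the class of finite (possibly empty) linearly ordered sets $x$ with a colouring $c:[x]^2\to A$ of pairs without monochromatic triangles, with the embeddings (injections preserving order and colours in both directions) as morphisms; put $\mathcal C=\mathcal C_Q$. For a class $\mathcal K$ of structures, $\sigma\mathcal K$ is the class of colimits of countable chains of embeddings between members of $\mathcal K$, again with embeddings as morphisms. For an embedding $x\subseteq y$, a \emph{one-point extension} is one where $y$ is generated by $x$ and a single element $t$; we write $y=\langle x,t\rangle$, and call it proper if $t\notin x$. A \emph{Katětov functor} for $\mathcal K$ is a functor $K:\mathcal K\to\sigma\mathcal K$ with a natural transformation $\eta$ from the inclusion to $K$ such that for every one-point extension $i:x\to y$ in $\mathcal K$ there is an embedding $g:y\to K(x)$ with $g\circ i=\eta_x$. A \emph{homogeneous one-point extension} of $M$ over $x\subseteq\langle x,t\rangle$, where $x\subseteq M$ and $\langle x,t\rangle\in\mathcal K$ is a proper one-point extension of $x\in\mathcal K$, is a structure $C\in\sigma\mathcal K$ generated by (embedded copies of) $M$ and $t$, with the embeddings of $M$ and $\langle x,t\rangle$ agreeing on $x$,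 such that every automorphism of $M$ fixing $x$ pointwise extends to an automorphism of $C$ fixing $\langle x,t\rangle$ pointwise. A \emph{nontrivial pair of embeddings} for $M$ is an embedding $e:M\to M$ that is not onto, together with an injective group homomorphism $E:\operatorname{Aut}(M)\to\operatorname{Aut}(M)$ with $E(\alpha)\circ e=e\circ\alpha$ for all $\alpha$. \textbf{Theorem.} $\mathcal C$ is a Fraïssé class; it has a Fraïssé limit, and it has no Katětov functor. Moreover, for (every copy of) the Fraïssé limit $M=\operatorname{Flim}(\mathcal C)$: 1. $M$ has no homogeneous one-point extension over any $x\subseteq\langle x,t\rangle$ as above (with $\mathcal K=\mathcal C$). 2. $M$ has no nontrivial pair of embeddings $(e,E)$. 3. There is a faithful functor from $\sigma\mathcal C$ to $\{M\}$ (the category with the single object $M$ and all self-embeddings of $M$). 4. For every $X\in\sigma\mathcal C$ there are an injective group homomorphism $\operatorname{Aut}(X)\to\operatorname{Aut}(M)$ and an injective monoid homomorphism $\operatorname{Emb}(X)\to\operatorname{Emb}(M)$. 5. Let $A_0\subseteq A_1\subseteq\cdots$ be subsets of $Q$ with union $Q$ and all $A_{i+1}\setminus A_i$ infinite, and let $\rho:Q\to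 A_0$ be a bijection. Then there are functors $K_i:\sigma\mathcal C_{A_i}\to\sigma\mathcal C_{A_{i+1}}$ with natural transformations $\nu^i$ from the inclusion to $K_i$, and a faithful functor $K_\omega:\sigma\mathcal C_{A_0}\to\{M\}$, such that: (a) For $X\in\sigma\mathcal C_{A_i}$ and a new point $\xi\in K_i(X)\setminus\nu^i_X[X]$, let $\operatorname{supp}(\xi)$ be the set of $a\in X$ for which the colour of $\{\nu^i_X(a),\xi\}$ is in $A_i$. Then $\operatorname{supp}(\xi)$ is finite. For every finite substructure $s\subseteq X$ and every proper one-point extension $\langle s,t\rangle\in\mathcal C_{A_i}$ there is exactly one new point $\xi$ with $\operatorname{supp}(\xi)=s$ for which $\nu^i_X|_s$ extends to an embedding $\langle s,t\rangle\to K_i(X)$ with $t\mapsto\xi$. The colours of pairs of new points are not in $A_i$. For every embedding $e:X\to Y$ in $\sigma\mathcal C_{A_i}$, $K_i(e)$ maps new points to new points, with $\operatorname{supp}(K_i(e)(\xi))=e[\operatorname{supp}(\xi)]$. (b) $K_\omega=\cdots\circ K_i\circ\cdots\circ K_1\circ K_0$, that is, naturally in $X$, $K_\omega(X)$ is the colimit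 of the chain $X\to K_0(X)\to K_1(K_0(X))\to\cdots$ given by the $\nu^i$. (c) Recolouring along $\rho$ is a functor $R:\sigma\mathcal C\to\sigma\mathcal C_{A_0}$ (up to natural isomorphism), and $K_\omega\circ R:\sigma\mathcal C\to\{M\}$ is faithful. -/

import Mathlib

open CategoryTheory FirstOrder FirstOrder.Language

namespace FraisseNoKatetov

/-! ### Generalities on classes of first-order structures and embeddings -/

section General

variable {L : FirstOrder.Language.{0, 0}}

/-- The category of (small) `L`-structures; its morphisms are the embeddings. -/
instance structureCategory : Category.{0} (Bundled.{0} L.Structure) where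
  Hom M N := M ↪[L] N
  id M := Embedding.refl L M
  comp f g := Embedding.comp g f

/-- The embedding underlying a morphism. -/
def emb {M N : Bundled.{0} L.Structure} (f : M ⟶ N) : M ↪[L] N := f

/-- The full subcategory spanned by a class `K` of structures, as a property of objects. -/
def classOf (K : Set (Bundled.{0} L.Structure)) : ObjectProperty (Bundled.{0} L.Structure) :=
  fun M => M ∈ K

/-- `σK`: the structures that are colimits of countable chains
`G 0 ↪ G 1 ↪ ⋯` of members of `K`. A cocone of embeddings over such a chain is a
colimit exactly when it is jointly surjective. -/
def sigma (K : Set (Bundled.{0} L.Structure)) : ObjectProperty (Bundled.{0} L.Structure) :=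
  fun M => ∃ (G : ℕ → Bundled.{0} L.Structure) (f : ∀ n, G n ⟶ G (n + 1)) (g : ∀ n, G n ⟶ M),
    (∀ n, G n ∈ K) ∧ (∀ n, f n ≫ g (n + 1) = g n) ∧ ∀ m : M, ∃ n, ∃ a : G n, emb (g n) a = m

/-- `i : x ⟶ y` exhibits `y` as an extension of `x` generated by `x` and the single element `t`. -/
def IsGeneratedOver {x y : Bundled.{0} L.Structure} (i : x ⟶ y) (t : y) : Prop :=
  Substructure.closure L (insert t (Set.range (emb i))) = ⊤

/-- `K` admits a Katětov functor: a functor `F : K ⥤ σK` and a natural transformation `η` from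
the inclusion to `F` such that every one-point extension `i : x ⟶ y` in `K` is realized
in `F x` over `η x`. -/
def HasKatetovFunctor (K : Set (Bundled.{0} L.Structure)) : Prop :=
  ∃ (F : (classOf K).FullSubcategory ⥤ (sigma K).FullSubcategory)
    (η : (classOf K).ι ⟶ F ⋙ (sigma K).ι),
    ∀ (x y : (classOf K).FullSubcategory) (i : x.obj ⟶ y.obj),
      (∃ t : y.obj, IsGeneratedOver i t) →
        ∃ g : y.obj ⟶ (F.obj x).obj, i ≫ g = η.app x

/-- In a commutative square with sides `i : x ⟶ y`, `e₁ : x ⟶ X`, `f : X ⟶ C`, `e₂ : y ⟶ C`,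
`C` is a homogeneous extension of `X` over `x ⊆ y`: every automorphism of `X` fixing `x` pointwise
extends to an automorphism of `C` fixing `y` pointwise. -/
structure IsHomogeneousExtension {x y X C : Bundled.{0} L.Structure}
    (i : x ⟶ y) (e₁ : x ⟶ X) (f : X ⟶ C) (e₂ : y ⟶ C) : Prop where
  comm : i ≫ e₂ = e₁ ≫ f
  extend : ∀ α : Aut X, e₁ ≫ α.hom = e₁ →
    ∃ β : Aut C, e₂ ≫ β.hom = e₂ ∧ f ≫ β.hom = α.hom ≫ f

/-- `M` has a homogeneous one-point extension: for some `x ⟶ M` with `x ∈ K` and some proper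
one-point extension `y = ⟨x, t⟩ ∈ K` of `x`, there is a homogeneous extension of `M` over `x ⊆ y`
which lies in `σK` and is generated by `M` and `t`. -/
def HasHomogeneousOnePointExtension (K : Set (Bundled.{0} L.Structure))
    (M : Bundled.{0} L.Structure) : Prop :=
  ∃ (x y C : Bundled.{0} L.Structure) (i : x ⟶ y) (t : y) (e₁ : x ⟶ M) (f : M ⟶ C) (e₂ : y ⟶ C),
    x ∈ K ∧ y ∈ K ∧ sigma K C ∧
    t ∉ Set.range (emb i) ∧ IsGeneratedOver i t ∧
    IsGeneratedOver f (emb e₂ t) ∧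
    IsHomogeneousExtension i e₁ f e₂

/-- `M` has a nontrivial pair of embeddings `(e, E)`: a self-embedding `e` of `M` that is not onto
and an injective group homomorphism `E : Aut M → Aut M` with `E α ∘ e = e ∘ α` for all `α`. -/
def HasNontrivialPair (M : Bundled.{0} L.Structure) : Prop :=
  ∃ (e : M ⟶ M) (E : Aut M →* Aut M),
    ¬ Function.Surjective (emb e) ∧ Function.Injective E ∧
    ∀ α : Aut M, e ≫ (E α).hom = α.hom ≫ e

end General

/-! ### Linear orders with coloured pairs -/

/-- Relation symbols: a strict order, and one binary relation for every colour. -/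
inductive ColRel (Q : Type) : ℕ → Type
  | lt : ColRel Q 2
  | col (q : Q) : ColRel Q 2

/-- The relational language of linear orders whose pairs are coloured by `Q`. -/
def colLang (Q : Type) : FirstOrder.Language.{0, 0} := ⟨fun _ => Empty, ColRel Q⟩

instance isEmpty_functions (Q : Type) (n : ℕ) : IsEmpty ((colLang Q).Functions n) :=
  inferInstanceAs (IsEmpty Empty)

section Coloured

variable {Q : Type}

/-- The order of a structure. -/
def Lt {M : Type} [(colLang Q).Structure M] (a b : M) : Prop :=
  Structure.RelMap (L := colLang Q) (ColRel.lt : ColRel Q 2) ![a, b]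

/-- `Col q a b`: the pair `{a, b}` has colour `q`. -/
def Col {M : Type} [(colLang Q).Structure M] (q : Q) (a b : M) : Prop :=
  Structure.RelMap (L := colLang Q) (ColRel.col q : ColRel Q 2) ![a, b]

/-- `M` is a linearly ordered set together with a function `[M]² → Q`
(the relations `Col q`, `q : Q`, being its graph) without monochromatic triangles. -/
structure IsTriangleFree (Q M : Type) [(colLang Q).Structure M] : Prop where
  order : IsStrictTotalOrder M (Lt (Q := Q))
  col_ne : ∀ (q : Q) (a b : M), Col q a b → a ≠ b
  col_symm : ∀ (q : Q) (a b : M), Col q a b → Col q b a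
  col_existsUnique : ∀ a b : M, a ≠ b → ∃! q : Q, Col q a b
  no_triangle : ∀ (q : Q) (a b c : M), ¬ (Col q a b ∧ Col q b c ∧ Col q a c)

variable (Q) in
/-- The class of finite linearly ordered sets with pairs coloured by `Q`,
without monochromatic triangles. -/
def finClass : Set (Bundled.{0} (colLang Q).Structure) :=
  {M | Finite M ∧ IsTriangleFree Q M}

/-- The members of `finClass Q` all of whose pairs have colours in `A`. -/
def finClassIn (A : Set Q) : Set (Bundled.{0} (colLang Q).Structure) :=
  {M | M ∈ finClass Q ∧ ∀ (q : Q) (a b : M), Col q a b → q ∈ A}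

/-- The structure with the same order, in which a pair of colour `q` is given the colour `ρ q`. -/
@[reducible] def recolorStructure {Q' : Type} (ρ : Q → Q') (M : Type) [(colLang Q).Structure M] :
    (colLang Q').Structure M where
  funMap f := f.elim
  RelMap r v := match r with
    | ColRel.lt => Structure.RelMap (L := colLang Q) (ColRel.lt : ColRel Q 2) v
    | ColRel.col q' => ∃ q, ρ q = q' ∧
        Structure.RelMap (L := colLang Q) (ColRel.col q : ColRel Q 2) v

/-- Recolouring along `ρ`, as a functor. -/
def recolor {Q' : Type} (ρ : Q → Q') :
    Bundled.{0} (colLang Q).Structure ⥤ Bundled.{0} (colLang Q').Structure where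
  obj M := ⟨M, recolorStructure ρ M⟩
  map {M N} f :=
    letI := recolorStructure ρ M
    letI := recolorStructure ρ N
    { toEmbedding := (emb f).toEmbedding
      map_fun' := fun f => f.elim
      map_rel' := fun r v => by
        cases r with
        | lt => exact (emb f).map_rel (ColRel.lt : ColRel Q 2) v
        | col q' =>
          exact exists_congr fun q => and_congr_right fun _ =>
            (emb f).map_rel (ColRel.col q : ColRel Q 2) v }

/-! ### Functors adding one point per type, and their `ω`-fold composition -/

/-- The category `σ𝒞_A`, where `𝒞_A` is the class `finClassIn A`. -/
abbrev SigmaIn (A : Set Q) := (sigma (finClassIn A)).FullSubcategory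

/-- The support of `ξ` with respect to `ν : X ⟶ Y`: the points of `X` which are
joined to `ξ` by a colour from `A`. -/
def support (A : Set Q) {X Y : Bundled.{0} (colLang Q).Structure} (ν : X ⟶ Y) (ξ : Y) : Set X :=
  {a | ∃ q ∈ A, Col q (emb ν a) ξ}

/-- The functor `K : σ𝒞_A ⥤ σ𝒞_B`, with the natural transformation `ν` from the inclusion, adds to
every `X` exactly one new point for every partial one-point type over `X`, that is, for every proper
one-point extension in `𝒞_A` of a finite substructure of `X` (which becomes the
support of the new point). All other new pairs get colours outside `A`, and `K` acts on the new
points by moving their supports. -/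
structure AddsOnePointPerType (A B : Set Q) (K : SigmaIn A ⥤ SigmaIn B)
    (ν : (sigma (finClassIn A)).ι ⟶ K ⋙ (sigma (finClassIn B)).ι) : Prop where
  support_finite : ∀ (X : SigmaIn A) (ξ : (K.obj X).obj), ξ ∉ Set.range (emb (ν.app X)) →
    (support A (X := X.obj) (ν.app X) ξ).Finite
  realize : ∀ (X : SigmaIn A) (s y : Bundled.{0} (colLang Q).Structure),
    s ∈ finClassIn A → y ∈ finClassIn A →
    ∀ (e : s ⟶ X.obj) (j : s ⟶ y) (t : y), t ∉ Set.range (emb j) → IsGeneratedOver j t →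
      ∃! ξ : (K.obj X).obj, ξ ∉ Set.range (emb (ν.app X)) ∧
        support A (X := X.obj) (ν.app X) ξ = Set.range (emb e) ∧
        ∃ g : y ⟶ (K.obj X).obj, j ≫ g = e ≫ ν.app X ∧ emb g t = ξ
  fresh : ∀ (X : SigmaIn A) (ξ ψ : (K.obj X).obj), ξ ∉ Set.range (emb (ν.app X)) →
    ψ ∉ Set.range (emb (ν.app X)) → ∀ q : Q, Col q ξ ψ → q ∉ A
  map_new : ∀ (X Y : SigmaIn A) (e : X ⟶ Y) (ξ : (K.obj X).obj),
    ξ ∉ Set.range (emb (ν.app X)) →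
      emb (K.map e).hom ξ ∉ Set.range (emb (ν.app Y)) ∧
      support A (X := Y.obj) (ν.app Y) (emb (K.map e).hom ξ) =
        emb e.hom '' support A (X := X.obj) (ν.app X) ξ

/-- The composition `K (n-1) ∘ ⋯ ∘ K 1 ∘ K 0`. -/
def iterComp (A : ℕ → Set Q) (K : ∀ i, SigmaIn (A i) ⥤ SigmaIn (A (i + 1))) :
    ∀ n, SigmaIn (A 0) ⥤ SigmaIn (A n)
  | 0 => 𝟭 _
  | n + 1 => iterComp A K n ⋙ K n

/-- `Kω` is the composition `⋯ ∘ K i ∘ ⋯ ∘ K 1 ∘ K 0`: naturally in `X`, the structure `Kω X`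
is the colimit of the chain `X ↪ K 0 X ↪ K 1 (K 0 X) ↪ ⋯` whose maps are given by the `ν i`. -/
def IsOmegaComposition (A : ℕ → Set Q) (K : ∀ i, SigmaIn (A i) ⥤ SigmaIn (A (i + 1)))
    (ν : ∀ i, (sigma (finClassIn (A i))).ι ⟶ K i ⋙ (sigma (finClassIn (A (i + 1)))).ι)
    (Kω : SigmaIn (A 0) ⥤ Bundled.{0} (colLang Q).Structure) : Prop :=
  ∃ μ : ∀ n, iterComp A K n ⋙ (sigma (finClassIn (A n))).ι ⟶ Kω,
    (∀ (n : ℕ) (X : SigmaIn (A 0)),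
      (ν n).app ((iterComp A K n).obj X) ≫ (μ (n + 1)).app X = (μ n).app X) ∧
    ∀ (X : SigmaIn (A 0)) (m : Kω.obj X), ∃ (n : ℕ) (a : ((iterComp A K n).obj X).obj),
      emb ((μ n).app X) a = m

end Coloured

end FraisseNoKatetov

open FraisseNoKatetov

/-!
Members of `σ𝒞_A` are the countable linear orders with pairs coloured from `A` without monochromatic
triangles (`sigma_finClassIn_iff`), so a colimit of such structures is again one.

*The functors.* A new point over `X` is a partial one-point type (`PartialType`): a finite support
`s ⊆ X` with a cut and colours from `A`. All remaining pairs need colours from `B \ A`, chosen in a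
way that depends only on the isomorphism type of the situation, so that embeddings of `X` act.
A point outside the support of a new point is joined to it by one fixed colour. A pair of new
points gets a colour encoding both types up to isomorphism, together with the colours in `X`
between the corresponding points of their supports (`PartialType.code`). Three new points with
the same pairwise codes would differ at corresponding points of their supports, which would form a
monochromatic triangle in `X` (`PartialType.eq_of_code_eq`). The order is defined by inserting a new
point immediately after the largest point of its support below it, ties being resolved
lexicographically (`Ext.key`).

*The Fraïssé limit.* A type over a finite subset of the colimit of the iterated extensions of `X`
lives at a finite stage and is realized at the next one. Hence the colimit is rich (`IsRich`) and,
by back and forth, it is a Fraïssé limit, whatever `X` is. Since `X` embeds naturally into the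
colimit, the functor `Kω` so obtained is faithful; its values are isomorphic to `M` and can
be replaced by `M`.

*The negative results.* They rest on monochromatic triangles with two vertices that automorphisms or
embeddings identify. A one-point type over `M` is never invariant under the automorphisms fixing
a finite set (`IsRich.not_invariant`), which excludes homogeneous one-point extensions.
Given a nontrivial pair `(e, E)`, the types over `e[M]` of the points of `M` form a countable set,
in which the automorphisms move the type of a point `t ∉ e[M]`. By a Baire category argument,
this type is invariant under the stabilizer of a finite set, which is again impossible.
In a Katětov functor, the point added to the empty structure would be joined by a single colour
to every point of every finite structure.
-/

namespace FraisseNoKatetov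

/-! ### Morphisms and their underlying functions -/

section Morphisms

variable {L : FirstOrder.Language.{0, 0}}

theorem hom_ext_apply {M N : Bundled.{0} L.Structure} {f g : M ⟶ N}
    (h : ∀ x, emb f x = emb g x) : f = g :=
  Embedding.ext h

@[simp]
theorem emb_comp {M N P : Bundled.{0} L.Structure} (f : M ⟶ N) (g : N ⟶ P) (x : M) :
    emb (f ≫ g) x = emb g (emb f x) := rfl

theorem emb_injective {M N : Bundled.{0} L.Structure} (f : M ⟶ N) :
    Function.Injective (emb f) := (emb f).injective

theorem emb_congr {M N : Bundled.{0} L.Structure} {f g : M ⟶ N} (h : f = g) (x : M) :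
    emb f x = emb g x := by rw [h]

/-- An isomorphism of structures, as an isomorphism in the category of structures. -/
def isoOfEquiv {M N : Bundled.{0} L.Structure} (e : M ≃[L] N) : M ≅ N where
  hom := e.toEmbedding
  inv := e.symm.toEmbedding
  hom_inv_id := hom_ext_apply fun x => e.symm_apply_apply x
  inv_hom_id := hom_ext_apply fun x => e.apply_symm_apply x

end Morphisms

/-! ### Coloured linear orders and their embeddings -/

section Coloured

variable {Q : Type}

section

variable {M N : Type} [(colLang Q).Structure M] [(colLang Q).Structure N]

theorem comp_pair {M N : Type} (f : M → N) (a b : M) : f ∘ ![a, b] = ![f a, f b] := by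
  ext i; fin_cases i <;> rfl

theorem lt_embedding_iff (f : M ↪[colLang Q] N) (a b : M) :
    Lt (Q := Q) (f a) (f b) ↔ Lt (Q := Q) a b := by
  have h := f.map_rel (ColRel.lt : ColRel Q 2) ![a, b]
  rwa [comp_pair] at h

theorem col_embedding_iff (f : M ↪[colLang Q] N) (q : Q) (a b : M) :
    Col q (f a) (f b) ↔ Col q a b := by
  have h := f.map_rel (ColRel.col q : ColRel Q 2) ![a, b]
  rwa [comp_pair] at h

theorem IsTriangleFree.lt_irrefl (h : IsTriangleFree Q M) (a : M) : ¬ Lt (Q := Q) a a :=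
  h.order.irrefl a

theorem IsTriangleFree.lt_trans (h : IsTriangleFree Q M) {a b c : M} (hab : Lt (Q := Q) a b)
    (hbc : Lt (Q := Q) b c) : Lt (Q := Q) a c :=
  h.order.trans a b c hab hbc

theorem IsTriangleFree.lt_asymm (h : IsTriangleFree Q M) {a b : M} (hab : Lt (Q := Q) a b) :
    ¬ Lt (Q := Q) b a :=
  fun hba => h.lt_irrefl a (h.lt_trans hab hba)

theorem IsTriangleFree.lt_or_lt (h : IsTriangleFree Q M) {a b : M} (hab : a ≠ b) :
    Lt (Q := Q) a b ∨ Lt (Q := Q) b a := by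
  by_contra hc
  rw [not_or] at hc
  exact hab (h.order.trichotomous a b hc.1 hc.2)

theorem IsTriangleFree.col_unique (h : IsTriangleFree Q M) {q r : Q} {a b : M} (hq : Col q a b)
    (hr : Col r a b) : q = r :=
  (h.col_existsUnique a b (h.col_ne q a b hq)).unique hq hr

/-- A map between coloured linear orders which preserves the order and the colours
is an embedding. -/
def mkEmbedding (hM : IsTriangleFree Q M) (hN : IsTriangleFree Q N) (f : M → N)
    (hlt : ∀ a b, Lt (Q := Q) a b → Lt (Q := Q) (f a) (f b))
    (hcol : ∀ (q : Q) (a b), Col q a b → Col q (f a) (f b)) : M ↪[colLang Q] N :=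
  have inj : Function.Injective f := fun a b hab => by
    by_contra hne
    rcases hM.lt_or_lt hne with h | h
    · exact hN.lt_irrefl (f b) (by simpa [hab] using hlt _ _ h)
    · exact hN.lt_irrefl (f b) (by simpa [hab] using hlt _ _ h)
  { toFun := f
    inj' := inj
    map_fun' := fun F => F.elim
    map_rel' := fun {n} r v => by
      cases r with
      | lt =>
        have hv : v = ![v 0, v 1] := by ext i; fin_cases i <;> rfl
        have hfv : f ∘ v = ![f (v 0), f (v 1)] := by ext i; fin_cases i <;> rfl
        rw [hfv, hv]
        change Lt (Q := Q) (f (v 0)) (f (v 1)) ↔ Lt (Q := Q) (v 0) (v 1)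
        refine ⟨fun h => ?_, hlt _ _⟩
        have hne : v 0 ≠ v 1 := fun he => hN.lt_irrefl _ (he ▸ h)
        exact (hM.lt_or_lt hne).resolve_right fun h' => hN.lt_asymm h (hlt _ _ h')
      | col q =>
        have hv : v = ![v 0, v 1] := by ext i; fin_cases i <;> rfl
        have hfv : f ∘ v = ![f (v 0), f (v 1)] := by ext i; fin_cases i <;> rfl
        rw [hfv, hv]
        change Col q (f (v 0)) (f (v 1)) ↔ Col q (v 0) (v 1)
        refine ⟨fun h => ?_, hcol _ _ _⟩
        have hne : v 0 ≠ v 1 := fun he => hN.col_ne _ _ _ h (by rw [he])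
        obtain ⟨r, hr, -⟩ := hM.col_existsUnique _ _ hne
        rwa [hN.col_unique h (hcol _ _ _ hr)] }

theorem IsTriangleFree.of_embedding (hN : IsTriangleFree Q N) (f : M ↪[colLang Q] N) :
    IsTriangleFree Q M where
  order :=
    { trichotomous := fun a b h₁ h₂ => f.injective (hN.order.trichotomous _ _
        (fun h => h₁ ((lt_embedding_iff f a b).1 h)) fun h => h₂ ((lt_embedding_iff f b a).1 h))
      irrefl := fun a h => hN.lt_irrefl (f a) ((lt_embedding_iff f a a).2 h)
      trans := fun a b c h₁ h₂ => (lt_embedding_iff f a c).1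
        (hN.lt_trans ((lt_embedding_iff f a b).2 h₁) ((lt_embedding_iff f b c).2 h₂)) }
  col_ne q a b h hab := hN.col_ne q (f a) (f b) ((col_embedding_iff f q a b).2 h) (by rw [hab])
  col_symm q a b h :=
    (col_embedding_iff f q b a).1 (hN.col_symm q _ _ ((col_embedding_iff f q a b).2 h))
  col_existsUnique a b hab := by
    simpa only [col_embedding_iff] using hN.col_existsUnique (f a) (f b) (f.injective.ne hab)
  no_triangle q a b c h := hN.no_triangle q (f a) (f b) (f c) (by simpa only [col_embedding_iff])

end

/-- The axioms of a coloured linear order involve at most three points at a time. -/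
theorem IsTriangleFree.of_forall_three {M : Type} [(colLang Q).Structure M]
    (h : ∀ a b c : M, ∃ (N : Bundled.{0} (colLang Q).Structure) (f : N ↪[colLang Q] M),
      IsTriangleFree Q N ∧ a ∈ Set.range f ∧ b ∈ Set.range f ∧ c ∈ Set.range f) :
    IsTriangleFree Q M where
  order :=
    { trichotomous := fun a b h₁ h₂ => by
        obtain ⟨N, f, hN, ⟨a, rfl⟩, ⟨b, rfl⟩, -⟩ := h a b b
        rw [lt_embedding_iff] at h₁ h₂
        rw [hN.order.trichotomous a b h₁ h₂]
      irrefl := fun a h₁ => by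
        obtain ⟨N, f, hN, ⟨a, rfl⟩, -⟩ := h a a a
        exact hN.lt_irrefl a ((lt_embedding_iff f a a).1 h₁)
      trans := fun a b c h₁ h₂ => by
        obtain ⟨N, f, hN, ⟨a, rfl⟩, ⟨b, rfl⟩, ⟨c, rfl⟩⟩ := h a b c
        rw [lt_embedding_iff] at h₁ h₂ ⊢
        exact hN.lt_trans h₁ h₂ }
  col_ne q a b h₁ := by
    obtain ⟨N, f, hN, ⟨a, rfl⟩, ⟨b, rfl⟩, -⟩ := h a b b
    exact f.injective.ne (hN.col_ne q a b ((col_embedding_iff f q a b).1 h₁))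
  col_symm q a b h₁ := by
    obtain ⟨N, f, hN, ⟨a, rfl⟩, ⟨b, rfl⟩, -⟩ := h a b b
    rw [col_embedding_iff] at h₁ ⊢
    exact hN.col_symm q a b h₁
  col_existsUnique a b hab := by
    obtain ⟨N, f, hN, ⟨a, rfl⟩, ⟨b, rfl⟩, -⟩ := h a b b
    simp only [col_embedding_iff]
    exact hN.col_existsUnique a b fun hne => hab (by rw [hne])
  no_triangle q a b c h₁ := by
    obtain ⟨N, f, hN, ⟨a, rfl⟩, ⟨b, rfl⟩, ⟨c, rfl⟩⟩ := h a b c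
    simp only [col_embedding_iff] at h₁
    exact hN.no_triangle q a b c h₁

/-! ### Colourings of pairs, and the structures they define -/

variable (Q) in
/-- A colouring of the pairs of points of `X` without monochromatic triangles, as a symmetric
function. Its values on the diagonal carry no information. -/
structure Colouring (X : Type) where
  col : X → X → Q
  col_comm : ∀ a b, col a b = col b a
  no_triangle : ∀ a b c, a ≠ b → b ≠ c → a ≠ c → ¬ (col a b = col b c ∧ col a b = col a c)

/-- The structure defined by a linear order and a colouring. -/
@[reducible] def Colouring.toStructure {X : Type} [LinearOrder X] (c : Colouring Q X) :
    (colLang Q).Structure X where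
  funMap f := f.elim
  RelMap r := match r with
    | ColRel.lt => fun v => v 0 < v 1
    | ColRel.col q => fun v => v 0 ≠ v 1 ∧ c.col (v 0) (v 1) = q

section

variable {X : Type} [LinearOrder X] (c : Colouring Q X)

theorem Colouring.isTriangleFree : letI := c.toStructure; IsTriangleFree Q X :=
  letI := c.toStructure
  { order :=
      { trichotomous := fun _ _ h₁ h₂ => le_antisymm (not_lt.1 h₂) (not_lt.1 h₁)
        irrefl := fun a => _root_.lt_irrefl a
        trans := fun _ _ _ => _root_.lt_trans }
    col_ne := fun _ _ _ h => h.1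
    col_symm := fun _ a b h => ⟨h.1.symm, (c.col_comm b a).trans h.2⟩
    col_existsUnique := fun a b hab =>
      ⟨c.col a b, ⟨hab, rfl⟩, fun _ hq => hq.2.symm⟩
    no_triangle := fun _ a b d h =>
      c.no_triangle a b d h.1.1 h.2.1.1 h.2.2.1
        ⟨h.1.2.trans h.2.1.2.symm, h.1.2.trans h.2.2.2.symm⟩ }

end

section

variable {X : Type} [(colLang Q).Structure X]

/-- The linear order of a coloured linear order. -/
@[reducible] noncomputable def IsTriangleFree.linearOrder (h : IsTriangleFree Q X) :
    LinearOrder X :=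
  haveI := h.order
  haveI : DecidableRel (Lt (Q := Q) (M := X)) := Classical.decRel _
  linearOrderOfSTO (Lt (Q := Q))

open Classical in
/-- The colouring of a coloured linear order. -/
noncomputable def IsTriangleFree.colouring [Inhabited Q] (h : IsTriangleFree Q X) :
    Colouring Q X where
  col a b := if hab : ∃ q : Q, Col q a b then hab.choose else default
  col_comm a b := by
    have : ∀ q : Q, Col q a b ↔ Col q b a := fun q => ⟨h.col_symm q a b, h.col_symm q b a⟩
    simp only [this]
  no_triangle a b c hab hbc hac := by
    have h₁ := (h.col_existsUnique a b hab).exists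
    have h₂ := (h.col_existsUnique b c hbc).exists
    have h₃ := (h.col_existsUnique a c hac).exists
    rw [dif_pos h₁, dif_pos h₂, dif_pos h₃]
    intro he
    exact h.no_triangle h₁.choose a b c
      ⟨h₁.choose_spec, he.1 ▸ h₂.choose_spec, he.2 ▸ h₃.choose_spec⟩

theorem IsTriangleFree.colouring_iff [Inhabited Q] (h : IsTriangleFree Q X) (q : Q) (a b : X) :
    Col q a b ↔ a ≠ b ∧ h.colouring.col a b = q := by
  have key : ∀ hab : ∃ q : Q, Col q a b, Col (h.colouring.col a b) a b := fun hab => by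
    rw [IsTriangleFree.colouring]
    dsimp only
    rw [dif_pos hab]
    exact hab.choose_spec
  constructor
  · exact fun hq => ⟨h.col_ne q a b hq, h.col_unique (key ⟨q, hq⟩) hq⟩
  · rintro ⟨hne, rfl⟩
    exact key (h.col_existsUnique a b hne).exists

end

/-! ### Countable coloured linear orders as colimits of chains -/

instance finite_closure {M : Type} [(colLang Q).Structure M] (s : Finset M) :
    Finite (Substructure.closure (colLang Q) (s : Set M)) := by
  have h := Substructure.closure_eq_of_isRelational (colLang Q) (s : Set M)
  exact Set.Finite.to_subtype (s := (Substructure.closure (colLang Q) (s : Set M) : Set M))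
    (by rw [h]; exact s.finite_toSet)

theorem exists_range_of_chain {L : FirstOrder.Language.{0, 0}} {M : Bundled.{0} L.Structure}
    {G : ℕ → Bundled.{0} L.Structure} {f : ∀ n, G n ⟶ G (n + 1)} {g : ∀ n, G n ⟶ M}
    (hfg : ∀ n, f n ≫ g (n + 1) = g n) (hg : ∀ m : M, ∃ n, ∃ a : G n, emb (g n) a = m)
    {s : Set M} (hs : s.Finite) : ∃ n₀, ∀ n ≥ n₀, s ⊆ Set.range (emb (g n)) := by
  have mono : Monotone fun n => Set.range (emb (g n)) := monotone_nat_of_le_succ fun n => by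
    rintro _ ⟨a, rfl⟩
    exact ⟨emb (f n) a, by rw [← hfg n]; rfl⟩
  induction s, hs using Set.Finite.induction_on with
  | empty => exact ⟨0, fun _ _ => Set.empty_subset _⟩
  | @insert a s _ _ ih =>
    obtain ⟨n₁, h₁⟩ := ih
    obtain ⟨n₂, b, hb⟩ := hg a
    exact ⟨max n₁ n₂, fun n hn => Set.insert_subset
      (mono (le_of_max_le_right hn) ⟨b, hb⟩) (h₁ n (le_of_max_le_left hn))⟩

/-- A colimit of a chain of countable coloured linear orders is again one. -/
theorem isTriangleFree_of_chain {M : Bundled.{0} (colLang Q).Structure}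
    {G : ℕ → Bundled.{0} (colLang Q).Structure} {f : ∀ n, G n ⟶ G (n + 1)} {g : ∀ n, G n ⟶ M}
    (hG : ∀ n, Countable (G n) ∧ IsTriangleFree Q (G n))
    (hfg : ∀ n, f n ≫ g (n + 1) = g n) (hg : ∀ m : M, ∃ n, ∃ a : G n, emb (g n) a = m) :
    Countable M ∧ IsTriangleFree Q M := by
  constructor
  · have := fun n => (hG n).1
    refine Function.Surjective.countable (f := fun p : Σ n, G n => emb (g p.1) p.2) fun m => ?_
    obtain ⟨n, a, h⟩ := hg m
    exact ⟨⟨n, a⟩, h⟩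
  · refine IsTriangleFree.of_forall_three fun a b c => ?_
    obtain ⟨n, hn⟩ := exists_range_of_chain hfg hg (Set.toFinite {a, b, c})
    refine ⟨G n, emb (g n), (hG n).2, hn n le_rfl (by simp), hn n le_rfl (by simp),
      hn n le_rfl (by simp)⟩

/-- The members of `σ𝒞_A` are the countable coloured linear orders with colours in `A`. -/
theorem sigma_finClassIn_iff {A : Set Q} {M : Bundled.{0} (colLang Q).Structure} :
    sigma (finClassIn A) M ↔
      Countable M ∧ IsTriangleFree Q M ∧ ∀ (q : Q) (a b : M), Col q a b → q ∈ A := by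
  constructor
  · rintro ⟨G, f, g, hG, hfg, hg⟩
    have h := isTriangleFree_of_chain
      (fun n => ⟨haveI := (hG n).1.1; inferInstance, (hG n).1.2⟩) hfg hg
    refine ⟨h.1, h.2, fun q a b hq => ?_⟩
    obtain ⟨n, hn⟩ := exists_range_of_chain hfg hg (Set.toFinite {a, b})
    obtain ⟨a, rfl⟩ := hn n le_rfl (show a ∈ _ by simp)
    obtain ⟨b, rfl⟩ := hn n le_rfl (show b ∈ _ by simp)
    exact (hG n).2 q a b ((col_embedding_iff (emb (g n)) q a b).1 hq)
  · classical
    rintro ⟨hc, hM, hA⟩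
    obtain ⟨e, he⟩ := exists_injective_nat M
    have fin : ∀ n, {a : M | e a < n}.Finite := fun n =>
      Set.Finite.preimage he.injOn (Set.finite_lt_nat n)
    let s : ℕ → Finset M := fun n => (fin n).toFinset
    have hs : ∀ n, (s n : Set M) ⊆ s (n + 1) := fun n a ha => by
      simp only [s, Set.Finite.coe_toFinset, Set.mem_ofPred_eq] at ha ⊢
      omega
    refine ⟨fun n => ⟨Substructure.closure (colLang Q) (s n : Set M), inferInstance⟩,
      fun n => Substructure.inclusion (Substructure.closure_mono (hs n)),
      fun n => Substructure.subtype _, fun n => ⟨⟨finite_closure _,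
        hM.of_embedding (Substructure.subtype _)⟩, fun q a b h => ?_⟩, fun n => rfl, fun m => ?_⟩
    · exact hA q a.1 b.1 ((col_embedding_iff (Substructure.subtype _) q a b).2 h)
    · exact ⟨e m + 1, ⟨m, Substructure.subset_closure (by simp [s])⟩, rfl⟩

theorem finClassIn_univ : finClassIn (Set.univ : Set Q) = finClass Q := by
  ext M
  simp [finClassIn]

theorem sigma_finClass_iff {M : Bundled.{0} (colLang Q).Structure} :
    sigma (finClass Q) M ↔ Countable M ∧ IsTriangleFree Q M := by
  rw [← finClassIn_univ, sigma_finClassIn_iff]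
  simp

end Coloured

/-! ### Partial one-point types -/

section PartialType

variable {Q X Y Z : Type} [LinearOrder X] [LinearOrder Y] [LinearOrder Z]

/-- A partial one-point type with colours in `A` over the coloured linear order `X`: a proper
one-point extension, with colours in `A`, of a finite subset of `X`. The subset and the colours of
its points are recorded as an increasing list, and the position of the extending point by the
largest element `cut` of the subset below it (`⊥` if there is none). -/
@[ext]
structure PartialType (c : Colouring Q X) (A : Set Q) where
  cut : WithBot X
  list : List (X × Q)
  sorted : list.Pairwise fun p r => p.1 < r.1
  cut_mem : ∀ a : X, cut = a → ∃ q, (a, q) ∈ list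
  mem : ∀ p ∈ list, p.2 ∈ A
  no_triangle : ∀ p ∈ list, ∀ r ∈ list, p.1 ≠ r.1 → ¬ (p.2 = r.2 ∧ c.col p.1 r.1 = p.2)

/-- An order preserving and colour preserving map. -/
structure IsColouredHom (c : Colouring Q X) (d : Colouring Q Y) (f : X → Y) : Prop where
  strictMono : StrictMono f
  col : ∀ a b, a ≠ b → d.col (f a) (f b) = c.col a b

variable {c : Colouring Q X} {d : Colouring Q Y} {A : Set Q}

namespace PartialType

theorem col_unique (ξ : PartialType c A) {a : X} {q r : Q} (hq : (a, q) ∈ ξ.list)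
    (hr : (a, r) ∈ ξ.list) : q = r := by
  by_contra hne
  have : Std.Symm fun p r : X × Q => p = r ∨ p.1 ≠ r.1 :=
    ⟨fun _ _ h => h.imp Eq.symm Ne.symm⟩
  have h := List.Pairwise.forall_of_forall (R := fun p r : X × Q => p = r ∨ p.1 ≠ r.1)
    (fun _ _ => Or.inl rfl) (ξ.sorted.imp fun h => Or.inr h.ne)
  rcases h hq hr with h | h
  · exact hne (congrArg Prod.snd h)
  · exact h rfl

/-- Moving a partial type along an embedding. -/
def map (f : X → Y) (hf : IsColouredHom c d f) (ξ : PartialType c A) : PartialType d A where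
  cut := ξ.cut.map f
  list := ξ.list.map (Prod.map f id)
  sorted := ξ.sorted.map _ fun _ _ h => hf.strictMono h
  cut_mem b hb := by
    obtain ⟨a, ha, rfl⟩ := WithBot.map_eq_some_iff.1 hb
    obtain ⟨q, hq⟩ := ξ.cut_mem a ha
    exact ⟨q, List.mem_map.2 ⟨_, hq, rfl⟩⟩
  mem p hp := by
    obtain ⟨r, hr, rfl⟩ := List.mem_map.1 hp
    exact ξ.mem r hr
  no_triangle p hp r hr hne := by
    obtain ⟨p, hp', rfl⟩ := List.mem_map.1 hp
    obtain ⟨r, hr', rfl⟩ := List.mem_map.1 hr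
    have hne' : p.1 ≠ r.1 := fun h => hne (congrArg f h)
    have := ξ.no_triangle p hp' r hr' hne'
    simpa [hf.col _ _ hne'] using this

theorem mem_map_list {f : X → Y} {hf : IsColouredHom c d f} {ξ : PartialType c A} {a : X} {q : Q} :
    (f a, q) ∈ (ξ.map f hf).list ↔ (a, q) ∈ ξ.list := by
  simp [map, hf.strictMono.injective.eq_iff]

theorem mem_map_list_iff {f : X → Y} {hf : IsColouredHom c d f} {ξ : PartialType c A} {b : Y}
    {q : Q} : (b, q) ∈ (ξ.map f hf).list ↔ ∃ a, f a = b ∧ (a, q) ∈ ξ.list := by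
  simp [map, and_comm]

/-- A partial type is determined by the colours and the position of its point relative to
its support. -/
theorem ext_of_forall {ξ ψ : PartialType c A} (h : ∀ p, p ∈ ξ.list ↔ p ∈ ψ.list)
    (hcut : ∀ p ∈ ξ.list, (p.1 : WithBot X) ≤ ξ.cut ↔ (p.1 : WithBot X) ≤ ψ.cut) : ξ = ψ := by
  have key : ∀ ξ ψ : PartialType c A,
      (∀ p ∈ ξ.list, (p.1 : WithBot X) ≤ ξ.cut → (p.1 : WithBot X) ≤ ψ.cut) → ξ.cut ≤ ψ.cut := by
    intro ξ ψ h
    rcases hξ : ξ.cut with _ | a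
    · exact bot_le
    · obtain ⟨q, hq⟩ := ξ.cut_mem a hξ
      exact h _ hq (le_of_eq hξ.symm)
  refine PartialType.ext (le_antisymm (key ξ ψ fun p hp => (hcut p hp).1)
    (key ψ ξ fun p hp => (hcut p ((h p).2 hp)).2)) ?_
  have : Std.Irrefl fun p r : X × Q => p.1 < r.1 := ⟨fun p => lt_irrefl p.1⟩
  have : Std.Antisymm fun p r : X × Q => p.1 < r.1 := ⟨fun _ _ h₁ h₂ => (lt_asymm h₁ h₂).elim⟩
  exact ξ.sorted.eq_of_mem_iff ψ.sorted h

/-- Every consistent choice of colours and of a cut on a finite set is a partial type. -/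
theorem exists_of_finset (c : Colouring Q X) (S : Finset X) (D : X → Prop) (g : X → Q)
    (hD : ∀ a ∈ S, ∀ b ∈ S, a < b → D b → D a) (hg : ∀ a ∈ S, g a ∈ A)
    (htri : ∀ a ∈ S, ∀ b ∈ S, a ≠ b → ¬ (g a = g b ∧ c.col a b = g a)) :
    ∃ ξ : PartialType c A, (∀ a q, (a, q) ∈ ξ.list ↔ a ∈ S ∧ q = g a) ∧
      ∀ a ∈ S, (a : WithBot X) ≤ ξ.cut ↔ D a := by
  classical
  have hmem : ∀ a q, (a, q) ∈ (S.sort (· ≤ ·)).map (fun a => (a, g a)) ↔ a ∈ S ∧ q = g a := by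
    intro a q
    simp only [List.mem_map, Finset.mem_sort, Prod.mk.injEq]
    exact ⟨fun ⟨b, hb, h₁, h₂⟩ => ⟨h₁ ▸ hb, h₁ ▸ h₂.symm⟩, fun ⟨h₁, h₂⟩ => ⟨a, h₁, rfl, h₂.symm⟩⟩
  refine ⟨⟨(S.filter D).max, (S.sort (· ≤ ·)).map fun a => (a, g a), ?_, ?_, ?_, ?_⟩, hmem, ?_⟩
  · exact (Finset.sortedLT_sort S).pairwise.map _ fun _ _ h => h
  · intro a ha
    exact ⟨g a, (hmem _ _).2 ⟨(Finset.mem_filter.1 (Finset.mem_of_max ha)).1, rfl⟩⟩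
  · rintro ⟨a, q⟩ hp
    obtain ⟨ha, rfl⟩ := (hmem _ _).1 hp
    exact hg a ha
  · rintro ⟨a, q⟩ hp ⟨b, r⟩ hr hne
    obtain ⟨ha, rfl⟩ := (hmem _ _).1 hp
    obtain ⟨hb, rfl⟩ := (hmem _ _).1 hr
    exact htri a ha b hb hne
  · intro a ha
    constructor
    · intro (h : (a : WithBot X) ≤ (S.filter D).max)
      rcases hm : (S.filter D).max with _ | b
      · rw [hm] at h; exact absurd h (WithBot.not_coe_le_bot a)
      · have hb := Finset.mem_filter.1 (Finset.mem_of_max hm)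
        rw [hm] at h
        rcases (WithBot.coe_le_coe.1 h).lt_or_eq with h | rfl
        · exact hD a ha b hb.1 h hb.2
        · exact hb.2
    · exact fun h => Finset.le_max (Finset.mem_filter.2 ⟨ha, h⟩)

end PartialType

/-! ### The colours of pairs of new points -/

section Code

open Classical in
/-- The colour of a pair of points, or `none` if they coincide. -/
noncomputable def Colouring.diff (c : Colouring Q X) (a b : X) : Option Q :=
  if a = b then none else some (c.col a b)

theorem Colouring.diff_comm (c : Colouring Q X) (a b : X) : c.diff a b = c.diff b a := by
  rw [diff, diff, c.col_comm a b]
  exact if_congr eq_comm rfl rfl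

/-- Three points with the same pairwise colours coincide. -/
theorem Colouring.eq_of_diff_eq (c : Colouring Q X) {x y z : X} (h₁ : c.diff x y = c.diff y z)
    (h₂ : c.diff x y = c.diff x z) : x = y := by
  by_contra hxy
  have hyz : y ≠ z := by rintro rfl; simp [diff, hxy] at h₁
  have hxz : x ≠ z := by rintro rfl; simp [diff, hxy] at h₂
  simp only [diff, if_neg hxy, if_neg hyz, if_neg hxz, Option.some.injEq] at h₁ h₂
  exact c.no_triangle x y z hxy hyz hxz ⟨h₁, h₂⟩

theorem IsColouredHom.diff {f : X → Y} (hf : IsColouredHom c d f) (a b : X) :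
    d.diff (f a) (f b) = c.diff a b := by
  unfold Colouring.diff
  by_cases hab : a = b
  · simp [hab]
  · simp [hab, hf.strictMono.injective.eq_iff, hf.col _ _ hab]

/-- The colour of a pair of cuts, or `none` if they coincide or one of them is `⊥`. -/
noncomputable def Colouring.cutDiff (c : Colouring Q X) : WithBot X → WithBot X → Option Q
  | some a, some b => c.diff a b
  | _, _ => none

theorem Colouring.cutDiff_comm (c : Colouring Q X) (a b : WithBot X) :
    c.cutDiff a b = c.cutDiff b a := by
  rcases a with _ | a <;> rcases b with _ | b <;> simp only [cutDiff, c.diff_comm]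

theorem IsColouredHom.cutDiff {f : X → Y} (hf : IsColouredHom c d f) (a b : WithBot X) :
    d.cutDiff (a.map f) (b.map f) = c.cutDiff a b := by
  rcases a with _ | a <;> rcases b with _ | b
  · rfl
  · rfl
  · rfl
  · exact hf.diff a b

theorem Colouring.eq_of_zipWith_diff_eq (c : Colouring Q X) :
    ∀ {l₁ l₂ l₃ : List (X × Q)}, l₁.map Prod.snd = l₂.map Prod.snd →
      l₂.map Prod.snd = l₃.map Prod.snd →
      List.zipWith (fun p r => c.diff p.1 r.1) l₁ l₂ =
        List.zipWith (fun p r => c.diff p.1 r.1) l₂ l₃ →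
      List.zipWith (fun p r => c.diff p.1 r.1) l₁ l₂ =
        List.zipWith (fun p r => c.diff p.1 r.1) l₁ l₃ → l₁ = l₂
  | [], [], _, _, _, _, _ => rfl
  | [], _ :: _, _, h, _, _, _ => by simp at h
  | _ :: _, [], _, h, _, _, _ => by simp at h
  | _ :: _, _ :: _, [], _, h, _, _ => by simp at h
  | p :: l₁, r :: l₂, s :: l₃, h₁, h₂, h₃, h₄ => by
    simp only [List.map_cons, List.cons.injEq, List.zipWith_cons_cons] at h₁ h₂ h₃ h₄
    rw [c.eq_of_zipWith_diff_eq h₁.2 h₂.2 h₃.2 h₄.2,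
      Prod.ext (c.eq_of_diff_eq h₃.1 h₄.1) h₁.1]

variable (Q) in
/-- The codes of pairs of partial types. -/
abbrev PairCode := Sym2 (List Q × Bool) × Option Q × List (Option Q)

open Classical in
/-- The part of a partial type which does not depend on the points of its support. -/
noncomputable def PartialType.shape (ξ : PartialType c A) : List Q × Bool :=
  (ξ.list.map Prod.snd, decide (ξ.cut = ⊥))

/-- The code of a pair of partial types: the unordered pair of their shapes, and the colours of the
pairs formed by the corresponding points of their supports. -/
noncomputable def PartialType.code (ξ ψ : PartialType c A) : PairCode Q :=
  (s(ξ.shape, ψ.shape), c.cutDiff ξ.cut ψ.cut,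
    List.zipWith (fun p r => c.diff p.1 r.1) ξ.list ψ.list)

theorem PartialType.code_comm (ξ ψ : PartialType c A) : ξ.code ψ = ψ.code ξ := by
  unfold code
  rw [Sym2.eq_swap, c.cutDiff_comm, List.zipWith_comm]
  simp only [c.diff_comm]

theorem PartialType.code_map {f : X → Y} (hf : IsColouredHom c d f) (ξ ψ : PartialType c A) :
    (ξ.map f hf).code (ψ.map f hf) = ξ.code ψ := by
  have hs : ∀ ξ : PartialType c A, (ξ.map f hf).shape = ξ.shape := fun ξ => by
    refine Prod.ext (List.map_map ..) (decide_eq_decide.2 WithBot.map_eq_bot_iff)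
  unfold code
  rw [hs, hs]
  simp only [map, hf.cutDiff, List.zipWith_map, Prod.map_fst, hf.diff]

/-- Three distinct partial types cannot have equal codes: in the first place where two of them
differ, their points would form a monochromatic triangle. -/
theorem PartialType.eq_of_code_eq {ξ ψ χ : PartialType c A} (h₁ : ξ.code ψ = ψ.code χ)
    (h₂ : ξ.code ψ = ξ.code χ) : ξ = ψ := by
  simp only [code, Prod.mk.injEq] at h₁ h₂
  have hs : ξ.shape = ψ.shape ∧ ψ.shape = χ.shape := by
    have h₃ := h₁.1
    have h₄ := h₂.1
    rw [Sym2.eq_iff] at h₃ h₄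
    rcases h₃ with h₃ | ⟨h₃, -⟩
    · exact h₃
    · rcases h₄ with ⟨-, h₄⟩ | ⟨-, h₄⟩
      · exact ⟨h₃.trans h₄.symm, h₄⟩
      · exact ⟨h₄.symm, h₄.trans h₃⟩
  simp only [shape, Prod.mk.injEq, decide_eq_decide] at hs
  refine PartialType.ext ?_ (c.eq_of_zipWith_diff_eq hs.1.1 hs.2.1 h₁.2.2 h₂.2.2)
  have h₃ := h₁.2.1
  have h₄ := h₂.2.1
  have h₅ := hs.1.2
  have h₆ := hs.2.2
  generalize ξ.cut = x at *
  generalize ψ.cut = y at *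
  generalize χ.cut = z at *
  rcases x with _ | x
  · exact (h₅.1 rfl).symm
  rcases y with _ | y
  · exact h₅.2 rfl
  rcases z with _ | z
  · exact absurd (h₆.2 rfl) WithBot.coe_ne_bot
  exact congrArg _ (c.eq_of_diff_eq h₃ h₄)

end Code

end PartialType

/-! ### Adding one point per partial type -/

section Ext

variable {Q X Y Z : Type} [LinearOrder X] [LinearOrder Y] [LinearOrder Z]

/-- An injective coding, by colours in `B \ A`, of the codes of pairs of partial types and
of one more value `none`. -/
structure FreshCode (A B : Set Q) where
  toFun : Option (PairCode Q) → Q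
  injective : Function.Injective toFun
  mem : ∀ x, toFun x ∈ B
  notMem : ∀ x, toFun x ∉ A

theorem FreshCode.nonempty [Countable Q] {A B : Set Q} (h : (B \ A).Infinite) :
    Nonempty (FreshCode A B) := by
  have : Countable (Sym2 (List Q × Bool)) :=
    inferInstanceAs (Countable (Quot _))
  obtain ⟨e, he⟩ := exists_injective_nat (Option (PairCode Q))
  have := h.to_subtype
  let i := Infinite.natEmbedding (B \ A : Set Q)
  exact ⟨⟨fun x => i (e x), fun x y hxy => he (i.injective (Subtype.ext hxy)),
    fun x => (i (e x)).2.1, fun x => (i (e x)).2.2⟩⟩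

/-- The coloured linear order `c` together with one new point for every partial type. -/
inductive Ext (c : Colouring Q X) (A : Set Q)
  | old (a : X) : Ext c A
  | new (ξ : PartialType c A) : Ext c A

variable {c : Colouring Q X} {d : Colouring Q Y} {e : Colouring Q Z} {A B : Set Q}

open Classical in
/-- The colour of the pair formed by the point `a` and the new point `ξ`: the prescribed one
if `a` is in the support of `ξ`, and one fixed fresh colour otherwise. -/
noncomputable def PartialType.colour (κ : FreshCode A B) (ξ : PartialType c A) (a : X) : Q :=
  if h : ∃ q, (a, q) ∈ ξ.list then h.choose else κ.toFun none

namespace PartialType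

theorem colour_of_mem (κ : FreshCode A B) {ξ : PartialType c A} {a : X} {q : Q}
    (h : (a, q) ∈ ξ.list) : ξ.colour κ a = q := by
  have h' : ∃ q, (a, q) ∈ ξ.list := ⟨q, h⟩
  rw [colour, dif_pos h']
  exact ξ.col_unique h'.choose_spec h

theorem colour_of_notMem (κ : FreshCode A B) {ξ : PartialType c A} {a : X}
    (h : ¬ ∃ q, (a, q) ∈ ξ.list) : ξ.colour κ a = κ.toFun none := by
  rw [colour, dif_neg h]

theorem colour_mem_iff (κ : FreshCode A B) {ξ : PartialType c A} {a : X} :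
    ξ.colour κ a ∈ A ↔ ∃ q, (a, q) ∈ ξ.list := by
  by_cases h : ∃ q, (a, q) ∈ ξ.list
  · obtain ⟨q, hq⟩ := h
    rw [colour_of_mem κ hq]
    exact iff_of_true (ξ.mem _ hq) ⟨q, hq⟩
  · rw [colour_of_notMem κ h]
    exact iff_of_false (κ.notMem _) h

theorem colour_ne_code (κ : FreshCode A B) (ξ : PartialType c A) (a : X) (x : PairCode Q) :
    ξ.colour κ a ≠ κ.toFun (some x) := by
  by_cases h : ∃ q, (a, q) ∈ ξ.list
  · exact fun he => κ.notMem (some x) (he ▸ (colour_mem_iff κ).2 h)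
  · rw [colour_of_notMem κ h]
    exact fun he => Option.some_ne_none x (κ.injective he).symm

theorem colour_map (κ : FreshCode A B) {f : X → Y} (hf : IsColouredHom c d f)
    (ξ : PartialType c A) (a : X) : (ξ.map f hf).colour κ (f a) = ξ.colour κ a := by
  by_cases h : ∃ q, (a, q) ∈ ξ.list
  · obtain ⟨q, hq⟩ := h
    rw [colour_of_mem κ hq, colour_of_mem κ (mem_map_list.2 hq)]
  · rw [colour_of_notMem κ h, colour_of_notMem κ]
    simpa only [mem_map_list] using h

theorem colour_no_triangle (κ : FreshCode A B) (hc : ∀ a b, a ≠ b → c.col a b ∈ A)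
    (ξ : PartialType c A) {a b : X} (hab : a ≠ b) :
    ¬ (ξ.colour κ a = ξ.colour κ b ∧ c.col a b = ξ.colour κ a) := by
  rintro ⟨h₁, h₂⟩
  obtain ⟨q, hq⟩ := (colour_mem_iff κ).1 (h₂ ▸ hc a b hab : ξ.colour κ a ∈ A)
  obtain ⟨r, hr⟩ := (colour_mem_iff κ).1 (h₁ ▸ h₂ ▸ hc a b hab : ξ.colour κ b ∈ A)
  rw [colour_of_mem κ hq] at h₁ h₂
  rw [colour_of_mem κ hr] at h₁
  exact ξ.no_triangle _ hq _ hr hab ⟨h₁, h₂⟩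

theorem map_id (ξ : PartialType c A) (h : IsColouredHom c c id) : ξ.map id h = ξ := by
  refine PartialType.ext ?_ ?_
  · simp [map]
  · simp [map]

theorem map_map {f : X → Y} {g : Y → Z} (hf : IsColouredHom c d f) (hg : IsColouredHom d e g)
    (hgf : IsColouredHom c e (g ∘ f)) (ξ : PartialType c A) :
    (ξ.map f hf).map g hg = ξ.map (g ∘ f) hgf := by
  refine PartialType.ext ?_ ?_
  · simp [map]
  · simp [map]

end PartialType

namespace Ext

/-- The position of a point: the new points with cut `a` follow `a` immediately, and are ordered
lexicographically among themselves. -/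
def key [LinearOrder Q] : Ext c A → WithBot X ×ₗ List (X ×ₗ Q)
  | old a => toLex (a, [])
  | new ξ => toLex (ξ.cut, ξ.list.map toLex)

theorem key_injective [LinearOrder Q] : Function.Injective (key : Ext c A → _) := by
  have h : ∀ (a : X) (ξ : PartialType c A), key (old a : Ext c A) ≠ key (new ξ) := by
    intro a ξ he
    simp only [key, EmbeddingLike.apply_eq_iff_eq, Prod.mk.injEq] at he
    obtain ⟨q, hq⟩ := ξ.cut_mem a he.1.symm
    rw [List.map_eq_nil_iff.1 he.2.symm] at hq
    exact List.not_mem_nil hq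
  rintro (a | ξ) (b | ψ) he
  · simp only [key, EmbeddingLike.apply_eq_iff_eq, Prod.mk.injEq, WithBot.coe_inj] at he
    rw [he.1]
  · exact (h _ _ he).elim
  · exact (h _ _ he.symm).elim
  · simp only [key, EmbeddingLike.apply_eq_iff_eq, Prod.mk.injEq] at he
    rw [PartialType.ext he.1 (List.map_injective_iff.2 toLex.injective he.2)]

noncomputable instance [LinearOrder Q] : LinearOrder (Ext c A) :=
  LinearOrder.lift' key key_injective

theorem lt_iff_key_lt [LinearOrder Q] {x y : Ext c A} : x < y ↔ key x < key y := Iff.rfl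

theorem old_lt_old [LinearOrder Q] {a b : X} : (old a : Ext c A) < old b ↔ a < b := by
  rw [lt_iff_key_lt, key, key, Prod.Lex.toLex_lt_toLex]
  simp

theorem old_lt_new [LinearOrder Q] {a : X} {ξ : PartialType c A} :
    (old a : Ext c A) < new ξ ↔ (a : WithBot X) ≤ ξ.cut := by
  rw [lt_iff_key_lt, key, key, Prod.Lex.toLex_lt_toLex, le_iff_lt_or_eq]
  refine or_congr Iff.rfl ⟨And.left, fun h => ⟨h, ?_⟩⟩
  obtain ⟨q, hq⟩ := ξ.cut_mem a h.symm
  rcases hl : ξ.list with _ | ⟨p, l⟩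
  · rw [hl] at hq
    exact absurd hq List.not_mem_nil
  · exact List.nil_lt_cons _ _

/-- The colours of the pairs of points. -/
noncomputable def col (κ : FreshCode A B) : Ext c A → Ext c A → Q
  | old a, old b => c.col a b
  | old a, new ξ => ξ.colour κ a
  | new ξ, old a => ξ.colour κ a
  | new ξ, new ψ => κ.toFun (some (ξ.code ψ))

theorem col_comm (κ : FreshCode A B) : ∀ x y : Ext c A, col κ x y = col κ y x
  | old a, old b => c.col_comm a b
  | old _, new _ => rfl
  | new _, old _ => rfl
  | new ξ, new ψ => by rw [col, col, ξ.code_comm]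

/-- The colouring of the extension. -/
noncomputable def colouring (κ : FreshCode A B) (hc : ∀ a b, a ≠ b → c.col a b ∈ A) :
    Colouring Q (Ext c A) where
  col := col κ
  col_comm := col_comm κ
  no_triangle := by
    rintro (a | ξ) (b | ψ) (d | χ) hab hbc hac ⟨h₁, h₂⟩
    · exact c.no_triangle a b d (ne_of_apply_ne _ hab) (ne_of_apply_ne _ hbc)
        (ne_of_apply_ne _ hac) ⟨h₁, h₂⟩
    · exact χ.colour_no_triangle κ hc (ne_of_apply_ne _ hab) ⟨h₂.symm.trans h₁, h₂⟩
    · exact ψ.colour_no_triangle κ hc (ne_of_apply_ne _ hac) ⟨h₁, h₂.symm⟩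
    · exact ψ.colour_ne_code κ a _ h₁
    · exact ξ.colour_no_triangle κ hc (ne_of_apply_ne _ hbc) ⟨h₂, h₁.symm⟩
    · exact ξ.colour_ne_code κ b _ h₂
    · exact ξ.colour_ne_code κ d _ h₂.symm
    · exact hab (congrArg _ (PartialType.eq_of_code_eq (Option.some.inj (κ.injective h₁))
        (Option.some.inj (κ.injective h₂))))

theorem colouring_mem (κ : FreshCode A B) (hc : ∀ a b, a ≠ b → c.col a b ∈ A) (hAB : A ⊆ B) :
    ∀ x y : Ext c A, x ≠ y → (colouring κ hc).col x y ∈ B := by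
  have h : ∀ (ξ : PartialType c A) (a : X), ξ.colour κ a ∈ B := fun ξ a => by
    by_cases ha : ∃ q, (a, q) ∈ ξ.list
    · exact hAB ((PartialType.colour_mem_iff κ).2 ha)
    · rw [PartialType.colour_of_notMem κ ha]
      exact κ.mem none
  rintro (a | ξ) (b | ψ) hne
  · exact hAB (hc a b (ne_of_apply_ne _ hne))
  · exact h ψ a
  · exact h ξ b
  · exact κ.mem _

theorem isColouredHom_old [LinearOrder Q] (κ : FreshCode A B)
    (hc : ∀ a b, a ≠ b → c.col a b ∈ A) : IsColouredHom c (colouring κ hc) old where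
  strictMono _ _ h := old_lt_old.2 h
  col _ _ _ := rfl

/-- The action of an embedding on the extensions: it moves the supports of the new points. -/
def map (f : X → Y) (hf : IsColouredHom c d f) : Ext c A → Ext d A
  | old a => old (f a)
  | new ξ => new (ξ.map f hf)

theorem isColouredHom_map [LinearOrder Q] (κ : FreshCode A B)
    (hc : ∀ a b, a ≠ b → c.col a b ∈ A) (hd : ∀ a b, a ≠ b → d.col a b ∈ A) {f : X → Y}
    (hf : IsColouredHom c d f) :
    IsColouredHom (colouring κ hc) (colouring κ hd) (map f hf) where
  strictMono x y h := by
    have hl : ∀ l l' : List (X × Q), l.map toLex < l'.map toLex →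
        (l.map (Prod.map f id)).map toLex < (l'.map (Prod.map f id)).map toLex := by
      intro l l' hll
      have := List.map_lt (f := fun p : X ×ₗ Q => toLex (Prod.map f id (ofLex p))) ?_ hll
      · simpa only [List.map_map, Function.comp_def, ofLex_toLex] using this
      · intro p r hpr
        rw [Prod.Lex.lt_iff] at hpr
        rw [Prod.Lex.toLex_lt_toLex]
        exact hpr.imp (fun h => hf.strictMono h) fun h => ⟨congrArg f h.1, h.2⟩
    have key_map : ∀ x : Ext c A, ∃ (m : WithBot X) (l : List (X × Q)),
        key x = toLex (m, l.map toLex) ∧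
        key (map f hf x) = toLex (m.map f, (l.map (Prod.map f id)).map toLex) := by
      rintro (a | ξ)
      · exact ⟨a, [], rfl, rfl⟩
      · exact ⟨ξ.cut, ξ.list, rfl, rfl⟩
    obtain ⟨m, l, h₁, h₂⟩ := key_map x
    obtain ⟨m', l', h₃, h₄⟩ := key_map y
    rw [lt_iff_key_lt, h₁, h₃, Prod.Lex.toLex_lt_toLex] at h
    rw [lt_iff_key_lt, h₂, h₄, Prod.Lex.toLex_lt_toLex]
    exact h.imp (fun h => hf.strictMono.withBot_map h) fun h =>
      ⟨congrArg (WithBot.map f) h.1, hl _ _ h.2⟩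
  col := by
    rintro (a | ξ) (b | ψ) hne
    · exact hf.col a b (ne_of_apply_ne _ hne)
    · exact ψ.colour_map κ hf a
    · exact ξ.colour_map κ hf b
    · exact congrArg (fun x => κ.toFun (some x)) (ξ.code_map hf ψ)

instance [Countable X] [Countable Q] : Countable (Ext c A) := by
  have : Countable (WithBot X) := inferInstanceAs (Countable (Option X))
  refine Function.Injective.countable (β := X ⊕ (WithBot X × List (X × Q)))
    (f := fun x => match x with
      | old a => Sum.inl a
      | new ξ => Sum.inr (ξ.cut, ξ.list)) ?_
  rintro (a | ξ) (b | ψ) h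
  · exact congrArg _ (Sum.inl.inj h)
  · cases h
  · cases h
  · have := Sum.inr.inj h
    rw [PartialType.ext (congrArg Prod.fst this) (congrArg Prod.snd this)]

end Ext

end Ext

/-! ### The functor adding one point per partial type -/

section Functor

variable {Q : Type}

theorem isTriangleFree_sigmaIn {A : Set Q} (X : SigmaIn A) : IsTriangleFree Q X.obj :=
  (sigma_finClassIn_iff.1 X.property).2.1

/-- The linear order of a member of `σ𝒞_A`. -/
@[reducible] noncomputable def sigmaOrder {A : Set Q} (X : SigmaIn A) : LinearOrder X.obj :=
  (isTriangleFree_sigmaIn X).linearOrder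

attribute [local instance] sigmaOrder

variable [Inhabited Q] {A B : Set Q}

/-- The colouring of a member of `σ𝒞_A`. -/
noncomputable def sigmaColouring (X : SigmaIn A) : Colouring Q X.obj :=
  (isTriangleFree_sigmaIn X).colouring

theorem col_sigmaIn_iff (X : SigmaIn A) (q : Q) (a b : X.obj) :
    Col q a b ↔ a ≠ b ∧ (sigmaColouring X).col a b = q :=
  (isTriangleFree_sigmaIn X).colouring_iff q a b

theorem sigmaColouring_mem (X : SigmaIn A) (a b : X.obj) (h : a ≠ b) :
    (sigmaColouring X).col a b ∈ A :=
  (sigma_finClassIn_iff.1 X.property).2.2 _ a b ((col_sigmaIn_iff X _ a b).2 ⟨h, rfl⟩)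

theorem isColouredHom_emb {X Y : SigmaIn A} (e : X.obj ⟶ Y.obj) :
    IsColouredHom (sigmaColouring X) (sigmaColouring Y) (emb e) where
  strictMono a b h := (lt_embedding_iff (emb e) a b).2 h
  col a b hab := ((col_sigmaIn_iff Y _ _ _).1 ((col_embedding_iff (emb e) _ a b).2
    ((col_sigmaIn_iff X _ a b).2 ⟨hab, rfl⟩))).2

variable [LinearOrder Q]

/-- The structure obtained from `X` by adding one point for every partial type. -/
noncomputable def extObj (κ : FreshCode A B) (X : SigmaIn A) : Bundled.{0} (colLang Q).Structure :=
  ⟨Ext (sigmaColouring X) A, (Ext.colouring κ (sigmaColouring_mem X)).toStructure⟩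

theorem extObj_isTriangleFree (κ : FreshCode A B) (X : SigmaIn A) :
    IsTriangleFree Q (extObj κ X) :=
  (Ext.colouring κ (sigmaColouring_mem X)).isTriangleFree

theorem col_extObj_iff (κ : FreshCode A B) (X : SigmaIn A) (q : Q)
    (x y : Ext (sigmaColouring X) A) :
    Col (M := extObj κ X) q x y ↔ x ≠ y ∧ Ext.col κ x y = q := Iff.rfl

theorem sigma_extObj [Countable Q] (κ : FreshCode A B) (hAB : A ⊆ B) (X : SigmaIn A) :
    sigma (finClassIn B) (extObj κ X) := by
  refine sigma_finClassIn_iff.2 ⟨?_, extObj_isTriangleFree κ X, fun q x y h => ?_⟩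
  · have := (sigma_finClassIn_iff.1 X.property).1
    exact inferInstanceAs (Countable (Ext (sigmaColouring X) A))
  · obtain ⟨hne, rfl⟩ := (col_extObj_iff κ X q x y).1 h
    exact Ext.colouring_mem κ (sigmaColouring_mem X) hAB x y hne

/-- The embedding of extensions induced by an embedding. -/
noncomputable def extMap (κ : FreshCode A B) {X Y : SigmaIn A} (e : X.obj ⟶ Y.obj) :
    extObj κ X ⟶ extObj κ Y :=
  have h := Ext.isColouredHom_map κ (sigmaColouring_mem X) (sigmaColouring_mem Y)
    (isColouredHom_emb e)
  mkEmbedding (extObj_isTriangleFree κ X) (extObj_isTriangleFree κ Y)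
    (Ext.map (emb e) (isColouredHom_emb e)) (fun _ _ hxy => h.strictMono hxy)
    fun _ x y hxy => ⟨h.strictMono.injective.ne hxy.1, (h.col x y hxy.1).trans hxy.2⟩

/-- The embedding of a structure into its extension. -/
noncomputable def extUnit (κ : FreshCode A B) (X : SigmaIn A) : X.obj ⟶ extObj κ X :=
  have h := Ext.isColouredHom_old κ (sigmaColouring_mem X)
  mkEmbedding (isTriangleFree_sigmaIn X) (extObj_isTriangleFree κ X) Ext.old
    (fun _ _ hab => h.strictMono hab) fun q a b hab => by
      obtain ⟨hne, rfl⟩ := (col_sigmaIn_iff X q a b).1 hab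
      exact ⟨h.strictMono.injective.ne hne, rfl⟩

/-- The functor adding one new point for every partial type. -/
noncomputable def extFunctor [Countable Q] (κ : FreshCode A B) (hAB : A ⊆ B) :
    SigmaIn A ⥤ SigmaIn B where
  obj X := ⟨extObj κ X, sigma_extObj κ hAB X⟩
  map e := ObjectProperty.homMk (extMap κ e.hom)
  map_id X := by
    refine ObjectProperty.hom_ext _ (hom_ext_apply fun x => ?_)
    rcases x with a | ξ
    · rfl
    · exact congrArg Ext.new (ξ.map_id (isColouredHom_emb (𝟙 X.obj)))
  map_comp e f := by
    refine ObjectProperty.hom_ext _ (hom_ext_apply fun x => ?_)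
    rcases x with a | ξ
    · rfl
    · exact congrArg Ext.new (ξ.map_map (isColouredHom_emb e.hom) (isColouredHom_emb f.hom)
        (isColouredHom_emb (e.hom ≫ f.hom))).symm

/-- The embeddings of structures into their extensions, as a natural transformation. -/
noncomputable def extNatTrans [Countable Q] (κ : FreshCode A B) (hAB : A ⊆ B) :
    (sigma (finClassIn A)).ι ⟶ extFunctor κ hAB ⋙ (sigma (finClassIn B)).ι where
  app X := extUnit κ X
  naturality _ _ _ := hom_ext_apply fun _ => rfl

theorem notMem_range_extUnit (κ : FreshCode A B) (X : SigmaIn A) (x : Ext (sigmaColouring X) A) :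
    x ∉ Set.range (emb (extUnit κ X)) ↔ ∃ ξ, x = Ext.new ξ := by
  rcases x with a | ξ
  · exact iff_of_false (fun h => h ⟨a, rfl⟩) (by rintro ⟨ξ, h⟩; cases h)
  · exact iff_of_true (by rintro ⟨a, h⟩; cases h) ⟨ξ, rfl⟩

theorem col_extUnit_new (κ : FreshCode A B) (X : SigmaIn A) (q : Q) (a : X.obj)
    (ξ : PartialType (sigmaColouring X) A) :
    Col (M := extObj κ X) q (emb (extUnit κ X) a) (Ext.new ξ) ↔ ξ.colour κ a = q :=
  ⟨fun h => h.2, fun h => ⟨by rintro ⟨⟩, h⟩⟩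

theorem mem_list_iff_col (κ : FreshCode A B) (X : SigmaIn A) (q : Q) (a : X.obj)
    (ξ : PartialType (sigmaColouring X) A) :
    (a, q) ∈ ξ.list ↔ q ∈ A ∧ Col (M := extObj κ X) q (emb (extUnit κ X) a) (Ext.new ξ) := by
  rw [col_extUnit_new]
  constructor
  · exact fun h => ⟨ξ.mem _ h, PartialType.colour_of_mem κ h⟩
  · rintro ⟨hq, rfl⟩
    obtain ⟨r, hr⟩ := (PartialType.colour_mem_iff κ).1 hq
    rwa [PartialType.colour_of_mem κ hr]

theorem support_extUnit (κ : FreshCode A B) (X : SigmaIn A)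
    (ξ : PartialType (sigmaColouring X) A) :
    support A (X := X.obj) (Y := extObj κ X) (extUnit κ X) (Ext.new ξ) =
      {a | ∃ q, (a, q) ∈ ξ.list} := by
  ext a
  exact exists_congr fun q => (mem_list_iff_col κ X q a ξ).symm

theorem lt_extUnit_new (κ : FreshCode A B) (X : SigmaIn A) (a : X.obj)
    (ξ : PartialType (sigmaColouring X) A) :
    Lt (Q := Q) (M := extObj κ X) (emb (extUnit κ X) a) (Ext.new ξ) ↔
      (a : WithBot X.obj) ≤ ξ.cut :=
  Ext.old_lt_new

omit [LinearOrder Q] in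
/-- Every consistent choice of colours from `A` and of a cut on a finite subset of `X` is a
partial type. -/
theorem exists_partialType (X : SigmaIn A) (S : Set X.obj) (hS : S.Finite) (D : X.obj → Prop)
    (g : X.obj → Q) (hD : ∀ a ∈ S, ∀ b ∈ S, Lt (Q := Q) a b → D b → D a) (hg : ∀ a ∈ S, g a ∈ A)
    (htri : ∀ a ∈ S, ∀ b ∈ S, ¬ (g a = g b ∧ Col (g a) a b)) :
    ∃ ξ : PartialType (sigmaColouring X) A, (∀ a q, (a, q) ∈ ξ.list ↔ a ∈ S ∧ q = g a) ∧
      ∀ a ∈ S, (a : WithBot X.obj) ≤ ξ.cut ↔ D a := by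
  obtain ⟨ξ, h₁, h₂⟩ := PartialType.exists_of_finset (A := A) (sigmaColouring X) hS.toFinset D g
    (fun a ha b hb => hD a (hS.mem_toFinset.1 ha) b (hS.mem_toFinset.1 hb))
    (fun a ha => hg a (hS.mem_toFinset.1 ha))
    (fun a ha b hb hab h => htri a (hS.mem_toFinset.1 ha) b (hS.mem_toFinset.1 hb)
      ⟨h.1, (col_sigmaIn_iff X _ a b).2 ⟨hab, h.2⟩⟩)
  exact ⟨ξ, by simpa only [hS.mem_toFinset] using h₁, fun a ha => h₂ a (hS.mem_toFinset.2 ha)⟩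

/-- The new points realize all consistent choices of colours from `A` and of cuts on finite
subsets. -/
theorem extObj_realize (κ : FreshCode A B) (X : SigmaIn A) (S : Set X.obj) (hS : S.Finite)
    (D : X.obj → Prop) (g : X.obj → Q)
    (hD : ∀ a ∈ S, ∀ b ∈ S, Lt (Q := Q) a b → D b → D a) (hg : ∀ a ∈ S, g a ∈ A)
    (htri : ∀ a ∈ S, ∀ b ∈ S, ¬ (g a = g b ∧ Col (g a) a b)) :
    ∃ t : extObj κ X, ∀ a ∈ S, (Lt (Q := Q) (emb (extUnit κ X) a) t ↔ D a) ∧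
      Col (g a) (emb (extUnit κ X) a) t := by
  obtain ⟨ξ, h₁, h₂⟩ := exists_partialType X S hS D g hD hg htri
  exact ⟨Ext.new ξ, fun a ha => ⟨(lt_extUnit_new κ X a ξ).trans (h₂ a ha),
    ((mem_list_iff_col κ X _ a ξ).1 ((h₁ a _).2 ⟨ha, rfl⟩)).2⟩⟩

omit [Inhabited Q] [LinearOrder Q] in
theorem eq_or_mem_range_of_isGeneratedOver {x y : Bundled.{0} (colLang Q).Structure} {i : x ⟶ y}
    {t : y} (h : IsGeneratedOver i t) (v : y) : v = t ∨ ∃ b, emb i b = v := by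
  have hv : v ∈ Substructure.closure (colLang Q) (insert t (Set.range (emb i))) := by
    rw [IsGeneratedOver] at h
    rw [h]
    exact Substructure.mem_top v
  rw [Substructure.mem_closure_iff_of_isRelational] at hv
  exact hv

/-- The description of the partial type over `X` given by an extension `s ⊆ ⟨s, t⟩` of
a substructure `e : s ⟶ X`. -/
structure Describes {X : SigmaIn A} {s y : Bundled.{0} (colLang Q).Structure} (e : s ⟶ X.obj)
    (j : s ⟶ y) (t : y) (ξ : PartialType (sigmaColouring X) A) : Prop where
  mem_list : ∀ a q, (a, q) ∈ ξ.list ↔ ∃ b, emb e b = a ∧ Col q (emb j b) t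
  le_cut : ∀ b, (emb e b : WithBot X.obj) ≤ ξ.cut ↔ Lt (Q := Q) (emb j b) t

omit [LinearOrder Q] in
theorem Describes.unique {X : SigmaIn A} {s y : Bundled.{0} (colLang Q).Structure} {e : s ⟶ X.obj}
    {j : s ⟶ y} {t : y} {ξ ψ : PartialType (sigmaColouring X) A} (hξ : Describes e j t ξ)
    (hψ : Describes e j t ψ) : ξ = ψ := by
  refine PartialType.ext_of_forall (fun p => (hξ.mem_list p.1 p.2).trans
    (hψ.mem_list p.1 p.2).symm) fun p hp => ?_
  obtain ⟨b, hb, -⟩ := (hξ.mem_list p.1 p.2).1 hp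
  rw [← hb]
  exact (hξ.le_cut b).trans (hψ.le_cut b).symm

omit [LinearOrder Q] in
theorem Describes.exists {X : SigmaIn A} {s y : Bundled.{0} (colLang Q).Structure} [Finite s]
    (hy : y ∈ finClassIn A) (e : s ⟶ X.obj) (j : s ⟶ y) {t : y}
    (ht : t ∉ Set.range (emb j)) : ∃ ξ, Describes e j t ξ := by
  have hne : ∀ b, emb j b ≠ t := fun b hb => ht ⟨b, hb⟩
  have hcol : ∀ b, ∃ q, Col q (emb j b) t := fun b => (hy.1.2.col_existsUnique _ _ (hne b)).exists
  choose k hk using hcol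
  have hinj := emb_injective e
  have hex : ∀ f : s → Q, ∃ g : X.obj → Q, ∀ b, g (emb e b) = f b := fun f =>
    ⟨Function.extend (emb e) f fun _ => default, fun b => hinj.extend_apply f _ b⟩
  obtain ⟨g, hg⟩ := hex k
  have hD : ∀ a ∈ Set.range (emb e), ∀ a' ∈ Set.range (emb e), Lt (Q := Q) a a' →
      (∃ b, emb e b = a' ∧ Lt (Q := Q) (emb j b) t) →
        ∃ b, emb e b = a ∧ Lt (Q := Q) (emb j b) t := by
    rintro _ ⟨b, rfl⟩ _ ⟨b', rfl⟩ hlt ⟨b'', h, h'⟩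
    obtain rfl := hinj h
    rw [lt_embedding_iff] at hlt
    exact ⟨b, rfl, hy.1.2.lt_trans ((lt_embedding_iff (emb j) _ _).2 hlt) h'⟩
  have hgA : ∀ a ∈ Set.range (emb e), g a ∈ A := by
    rintro _ ⟨b, rfl⟩
    rw [hg]
    exact hy.2 _ _ _ (hk b)
  have htri : ∀ a ∈ Set.range (emb e), ∀ a' ∈ Set.range (emb e),
      ¬ (g a = g a' ∧ Col (g a) a a') := by
    rintro _ ⟨b, rfl⟩ _ ⟨b', rfl⟩
    rw [hg, hg, col_embedding_iff, ← col_embedding_iff (emb j)]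
    rintro ⟨h, h'⟩
    exact hy.1.2.no_triangle (k b) (emb j b) (emb j b') t ⟨h', h ▸ hk b', hk b⟩
  obtain ⟨ξ, h₁, h₂⟩ := exists_partialType X _ (Set.finite_range _) _ g hD hgA htri
  refine ⟨ξ, ⟨fun a q => (h₁ a q).trans ?_, fun b => (h₂ _ ⟨b, rfl⟩).trans ?_⟩⟩
  · constructor
    · rintro ⟨⟨b, rfl⟩, rfl⟩
      exact ⟨b, rfl, (hg b).symm ▸ hk b⟩
    · rintro ⟨b, rfl, h⟩
      exact ⟨⟨b, rfl⟩, by rw [hg b]; exact hy.1.2.col_unique h (hk b)⟩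
  · exact ⟨fun ⟨b', h, h'⟩ => hinj h ▸ h', fun h => ⟨b, rfl, h⟩⟩

/-- A partial type describes the extension `s ⊆ ⟨s, t⟩` exactly when its new point
realizes this extension and has support `s`. -/
theorem describes_iff (κ : FreshCode A B) {X : SigmaIn A}
    {s y : Bundled.{0} (colLang Q).Structure} (hy : y ∈ finClassIn A) (e : s ⟶ X.obj) (j : s ⟶ y)
    {t : y} (ht : t ∉ Set.range (emb j)) (hgen : IsGeneratedOver j t)
    (ξ : PartialType (sigmaColouring X) A) :
    Describes e j t ξ ↔
      support A (X := X.obj) (Y := extObj κ X) (extUnit κ X) (Ext.new ξ) = Set.range (emb e) ∧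
      ∃ g : y ⟶ extObj κ X, j ≫ g = e ≫ extUnit κ X ∧ emb g t = Ext.new ξ := by
  classical
  have hne : ∀ b, emb j b ≠ t := fun b hb => ht ⟨b, hb⟩
  rw [support_extUnit]
  constructor
  · intro h
    refine ⟨?_, ?_⟩
    · ext a
      constructor
      · rintro ⟨q, hq⟩
        obtain ⟨b, hb, -⟩ := (h.mem_list a q).1 hq
        exact ⟨b, hb⟩
      · rintro ⟨b, rfl⟩
        obtain ⟨q, hq⟩ := (hy.1.2.col_existsUnique _ _ (hne b)).exists
        exact ⟨q, (h.mem_list _ q).2 ⟨b, rfl, hq⟩⟩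
    · let G : y → extObj κ X :=
        Function.extend (emb j) (fun b => emb (extUnit κ X) (emb e b)) fun _ => Ext.new ξ
      have hGj : ∀ b, G (emb j b) = emb (extUnit κ X) (emb e b) :=
        (emb_injective j).extend_apply _ _
      have hGt : G t = Ext.new ξ := Function.extend_apply' _ _ _ fun ⟨b, hb⟩ => hne b hb
      have hlt : ∀ b, Lt (Q := Q) (emb (extUnit κ X) (emb e b)) (Ext.new ξ : extObj κ X) ↔
          Lt (Q := Q) (emb j b) t := fun b =>
        (lt_extUnit_new κ X _ ξ).trans (h.le_cut b)
      have hcol : ∀ q b, Col q (emb j b) t →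
          Col q (emb (extUnit κ X) (emb e b)) (Ext.new ξ : extObj κ X) := fun q b hb =>
        ((mem_list_iff_col κ X q _ ξ).1 ((h.mem_list _ q).2 ⟨b, rfl, hb⟩)).2
      have hX := extObj_isTriangleFree κ X
      refine ⟨mkEmbedding hy.1.2 hX G ?_ ?_, hom_ext_apply hGj, hGt⟩
      · intro v w hvw
        obtain rfl | ⟨b, rfl⟩ := eq_or_mem_range_of_isGeneratedOver hgen v <;>
          obtain rfl | ⟨b', rfl⟩ := eq_or_mem_range_of_isGeneratedOver hgen w
        · exact absurd hvw (hy.1.2.lt_irrefl _)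
        · rw [hGt, hGj]
          refine (hX.lt_or_lt ?_).resolve_right fun h' => hy.1.2.lt_asymm hvw ((hlt b').1 h')
          rintro ⟨⟩
        · rw [hGt, hGj]
          exact (hlt b).2 hvw
        · rw [hGj, hGj, lt_embedding_iff, lt_embedding_iff, ← lt_embedding_iff (emb j)]
          exact hvw
      · intro q v w hvw
        obtain rfl | ⟨b, rfl⟩ := eq_or_mem_range_of_isGeneratedOver hgen v <;>
          obtain rfl | ⟨b', rfl⟩ := eq_or_mem_range_of_isGeneratedOver hgen w
        · exact absurd rfl (hy.1.2.col_ne _ _ _ hvw)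
        · rw [hGt, hGj]
          exact hX.col_symm _ _ _ (hcol q b' (hy.1.2.col_symm _ _ _ hvw))
        · rw [hGt, hGj]
          exact hcol q b hvw
        · rw [hGj, hGj, col_embedding_iff, col_embedding_iff, ← col_embedding_iff (emb j)]
          exact hvw
  · rintro ⟨hs, g, hg, hgt⟩
    have hgj : ∀ b, emb g (emb j b) = emb (extUnit κ X) (emb e b) := fun b => emb_congr hg b
    refine ⟨fun a q => ⟨fun h => ?_, ?_⟩, fun b => ?_⟩
    · obtain ⟨b, rfl⟩ : a ∈ Set.range (emb e) := hs ▸ ⟨q, h⟩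
      refine ⟨b, rfl, ?_⟩
      rw [← col_embedding_iff (emb g), hgj, hgt]
      exact ((mem_list_iff_col κ X q _ ξ).1 h).2
    · rintro ⟨b, rfl, h⟩
      refine (mem_list_iff_col κ X q _ ξ).2 ⟨hy.2 _ _ _ h, ?_⟩
      rwa [← hgj, ← hgt, col_embedding_iff]
    · rw [← lt_extUnit_new κ, ← hgj, ← hgt, lt_embedding_iff]

theorem addsOnePointPerType_extFunctor [Countable Q] (κ : FreshCode A B) (hAB : A ⊆ B) :
    AddsOnePointPerType A B (extFunctor κ hAB) (extNatTrans κ hAB) where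
  support_finite X ξ hξ := by
    obtain ⟨ξ, rfl⟩ := (notMem_range_extUnit κ X ξ).1 hξ
    refine Set.Finite.subset (ξ.list.map Prod.fst).finite_toSet fun a ha => ?_
    obtain ⟨q, hq⟩ := (Set.ext_iff.1 (support_extUnit κ X ξ) a).1 ha
    exact List.mem_map.2 ⟨_, hq, rfl⟩
  realize X s y hs hy e j t ht hgen := by
    have := hs.1.1
    obtain ⟨ξ, hξ⟩ := Describes.exists hy e j ht
    have h := (describes_iff κ hy e j ht hgen ξ).1 hξ
    refine ⟨Ext.new ξ, ⟨(notMem_range_extUnit κ X _).2 ⟨ξ, rfl⟩, h⟩, ?_⟩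
    rintro ψ ⟨hψ, h'⟩
    obtain ⟨ψ, rfl⟩ := (notMem_range_extUnit κ X ψ).1 hψ
    rw [((describes_iff κ hy e j ht hgen ψ).2 h').unique hξ]
  fresh X ξ ψ hξ hψ q hq := by
    obtain ⟨ξ, rfl⟩ := (notMem_range_extUnit κ X ξ).1 hξ
    obtain ⟨ψ, rfl⟩ := (notMem_range_extUnit κ X ψ).1 hψ
    obtain ⟨-, rfl⟩ := (col_extObj_iff κ X q _ _).1 hq
    exact κ.notMem _
  map_new X Y e ξ hξ := by
    obtain ⟨ξ, rfl⟩ := (notMem_range_extUnit κ X ξ).1 hξ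
    refine ⟨(notMem_range_extUnit κ Y _).2 ⟨ξ.map (emb e.hom) (isColouredHom_emb e.hom), rfl⟩, ?_⟩
    refine (support_extUnit κ Y (ξ.map (emb e.hom) (isColouredHom_emb e.hom))).trans
      (Eq.trans ?_ (congrArg (Set.image (emb e.hom)) (support_extUnit κ X ξ)).symm)
    ext b
    simp only [PartialType.mem_map_list_iff, Set.mem_ofPred_eq, Set.mem_image]
    exact ⟨fun ⟨q, a, h, h'⟩ => ⟨a, ⟨q, h'⟩, h⟩, fun ⟨a, ⟨q, h'⟩, h⟩ => ⟨q, a, h, h'⟩⟩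

end Functor

/-! ### The one-point extension property and the Fraïssé limit -/

section Rich

variable {Q : Type}

variable (Q) in
/-- A coloured linear order is rich if every consistent choice of colours and of a cut on a finite
subset is realized by a point. -/
structure IsRich (M : Type) [(colLang Q).Structure M] : Prop where
  isTriangleFree : IsTriangleFree Q M
  realize : ∀ (S : Set M), S.Finite → ∀ (D : M → Prop) (g : M → Q),
    (∀ a ∈ S, ∀ b ∈ S, Lt (Q := Q) a b → D b → D a) →
    (∀ a ∈ S, ∀ b ∈ S, ¬ (g a = g b ∧ Col (g a) a b)) →
    ∃ t, ∀ a ∈ S, (Lt (Q := Q) a t ↔ D a) ∧ Col (g a) a t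

section

variable {M N : Type} [(colLang Q).Structure M] [(colLang Q).Structure N]

theorem IsRich.of_equiv (hM : IsRich Q M) (e : M ≃[colLang Q] N) : IsRich Q N where
  isTriangleFree := hM.isTriangleFree.of_embedding e.symm.toEmbedding
  realize S hS D g hD hg := by
    obtain ⟨t, ht⟩ := hM.realize (e ⁻¹' S) (hS.preimage e.injective.injOn) (fun a => D (e a))
      (fun a => g (e a))
      (fun a ha b hb hab => hD _ ha _ hb ((lt_embedding_iff e.toEmbedding a b).2 hab))
      (fun a ha b hb h => hg _ ha _ hb ⟨h.1, (col_embedding_iff e.toEmbedding _ a b).2 h.2⟩)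
    refine ⟨e t, fun a ha => ?_⟩
    obtain ⟨a, rfl⟩ := e.surjective a
    exact ⟨(lt_embedding_iff e.toEmbedding a t).trans (ht a ha).1,
      (col_embedding_iff e.toEmbedding _ a t).2 (ht a ha).2⟩

/-- An embedding of a finite substructure `S` into a rich structure extends to one more point. -/
theorem IsRich.exists_realization (hM : IsRich Q M) (hN : IsTriangleFree Q N)
    {S : (colLang Q).Substructure N} (hS : S.FG) (f : S ↪[colLang Q] M) {m : N} (hm : m ∉ S) :
    ∃ t : M, ∀ b : S, (Lt (Q := Q) (f b) t ↔ Lt (Q := Q) b.1 m) ∧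
      ∀ q : Q, Col q b.1 m → Col q (f b) t := by
  have := hS.finite
  have hne : ∀ b : S, b.1 ≠ m := fun b hb => hm (hb ▸ b.2)
  have hcol : ∀ b : S, ∃ q, Col q b.1 m := fun b => (hN.col_existsUnique _ _ (hne b)).exists
  choose k hk using hcol
  rcases isEmpty_or_nonempty S with hE | ⟨⟨b₀⟩⟩
  · obtain ⟨t, -⟩ : ∃ t : M, True := by
      by_contra h
      have : IsEmpty M := ⟨fun t => h ⟨t, trivial⟩⟩
      obtain ⟨t, -⟩ := hM.realize ∅ Set.finite_empty isEmptyElim isEmptyElim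
        (fun a => isEmptyElim a) fun a => isEmptyElim a
      exact isEmptyElim t
    exact ⟨t, fun b => hE.elim b⟩
  let g : M → Q := Function.extend f k fun _ => k b₀
  have hg : ∀ b, g (f b) = k b := f.injective.extend_apply _ _
  obtain ⟨t, ht⟩ := hM.realize (Set.range f) (Set.finite_range _)
    (fun a => ∃ b : S, f b = a ∧ Lt (Q := Q) b.1 m) g
    (by
      rintro _ ⟨b, rfl⟩ _ ⟨b', rfl⟩ hlt ⟨b'', h, h'⟩
      obtain rfl := f.injective h
      rw [lt_embedding_iff, ← lt_embedding_iff S.subtype] at hlt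
      exact ⟨b, rfl, hN.lt_trans hlt h'⟩)
    (by
      rintro _ ⟨b, rfl⟩ _ ⟨b', rfl⟩
      rw [hg, hg, col_embedding_iff, ← col_embedding_iff S.subtype]
      rintro ⟨h, h'⟩
      exact hN.no_triangle (k b) b.1 b'.1 m ⟨h', h ▸ hk b', hk b⟩)
  refine ⟨t, fun b => ⟨(ht _ ⟨b, rfl⟩).1.trans ?_, fun q hq => ?_⟩⟩
  · exact ⟨fun ⟨b', h, h'⟩ => f.injective h ▸ h', fun h => ⟨b, rfl, h⟩⟩
  · rw [hN.col_unique hq (hk b), ← hg b]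
    exact (ht _ ⟨b, rfl⟩).2

theorem IsRich.isExtensionPair (hM : IsRich Q M) (hN : IsTriangleFree Q N) :
    (colLang Q).IsExtensionPair N M := by
  classical
  rw [isExtensionPair_iff_exists_embedding_closure_singleton_sup]
  intro S hS f m
  have hsup : ∀ v : (Substructure.closure (colLang Q) {m} ⊔ S : (colLang Q).Substructure N),
      v.1 ∉ S → v.1 = m := by
    rintro ⟨v, hv⟩ hvS
    have hle : Substructure.closure (colLang Q) {m} ⊔ S ≤
        Substructure.closure (colLang Q) (insert m (S : Set N)) :=
      sup_le (Substructure.closure_mono (by simp))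
        fun a ha => Substructure.subset_closure (Set.mem_insert_of_mem _ ha)
    have := hle hv
    rw [Substructure.mem_closure_iff_of_isRelational] at this
    exact this.resolve_right hvS
  by_cases hm : m ∈ S
  · have hle : Substructure.closure (colLang Q) {m} ⊔ S ≤ S :=
      sup_le (Substructure.closure_le.2 (by simpa using hm)) le_rfl
    exact ⟨f.comp (Substructure.inclusion hle), rfl⟩
  · obtain ⟨t, ht⟩ := hM.exists_realization hN hS f hm
    let G : (Substructure.closure (colLang Q) {m} ⊔ S : (colLang Q).Substructure N) → M :=
      fun v => if h : v.1 ∈ S then f ⟨v.1, h⟩ else t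
    have hG : ∀ v (h : v.1 ∈ S), G v = f ⟨v.1, h⟩ := fun v h => dif_pos h
    have hGt : ∀ v : (Substructure.closure (colLang Q) {m} ⊔ S : (colLang Q).Substructure N),
      v.1 ∉ S → G v = t := fun v h => dif_neg h
    have hsub := hN.of_embedding
      (Substructure.closure (colLang Q) {m} ⊔ S : (colLang Q).Substructure N).subtype
    have hne : ∀ b : S, f b ≠ t := fun b => by
      obtain ⟨q, hq, -⟩ := hN.col_existsUnique b.1 m fun h => hm (h ▸ b.2)
      exact hM.isTriangleFree.col_ne q _ _ ((ht b).2 q hq)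
    refine ⟨mkEmbedding hsub hM.isTriangleFree G ?_ ?_, ?_⟩
    · intro v w hvw
      have hvw' : Lt (Q := Q) v.1 w.1 := (lt_embedding_iff (Substructure.subtype _) v w).2 hvw
      by_cases hv : v.1 ∈ S <;> by_cases hw : w.1 ∈ S
      · rw [hG v hv, hG w hw, lt_embedding_iff, ← lt_embedding_iff S.subtype]
        exact hvw'
      · rw [hG v hv, hGt w hw]
        rw [hsup w hw] at hvw'
        exact (ht ⟨v.1, hv⟩).1.2 hvw'
      · rw [hG w hw, hGt v hv]
        rw [hsup v hv] at hvw'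
        refine (hM.isTriangleFree.lt_or_lt (hne ⟨w.1, hw⟩)).resolve_left fun h => ?_
        exact hN.lt_asymm hvw' ((ht ⟨w.1, hw⟩).1.1 h)
      · rw [hsup v hv, hsup w hw] at hvw'
        exact absurd hvw' (hN.lt_irrefl m)
    · intro q v w hvw
      have hvw' : Col q v.1 w.1 := (col_embedding_iff (Substructure.subtype _) q v w).2 hvw
      by_cases hv : v.1 ∈ S <;> by_cases hw : w.1 ∈ S
      · rw [hG v hv, hG w hw, col_embedding_iff, ← col_embedding_iff S.subtype]
        exact hvw'
      · rw [hG v hv, hGt w hw]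
        rw [hsup w hw] at hvw'
        exact (ht ⟨v.1, hv⟩).2 q hvw'
      · rw [hG w hw, hGt v hv]
        rw [hsup v hv] at hvw'
        exact hM.isTriangleFree.col_symm _ _ _
          ((ht ⟨w.1, hw⟩).2 q (hN.col_symm _ _ _ hvw'))
      · rw [hsup v hv, hsup w hw] at hvw'
        exact absurd rfl (hN.col_ne _ _ _ hvw')
    · ext b
      exact (hG (Substructure.inclusion le_sup_right b) b.2).symm

theorem IsRich.isUltrahomogeneous [Countable M] (hM : IsRich Q M) :
    (colLang Q).IsUltrahomogeneous M :=
  (isUltrahomogeneous_iff_IsExtensionPair Structure.cg_of_countable).2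
    (hM.isExtensionPair hM.isTriangleFree)

/-- The age of a rich structure consists of all finite coloured linear orders: they are embedded
point by point. -/
theorem IsRich.age_eq (hM : IsRich Q M) : (colLang Q).age M = finClass Q := by
  ext N
  constructor
  · rintro ⟨hfg, ⟨f⟩⟩
    exact ⟨hfg.finite, hM.isTriangleFree.of_embedding f⟩
  · rintro ⟨hfin, hN⟩
    refine ⟨Structure.FG.of_finite, ?_⟩
    have : IsEmpty (colLang Q).Constants := inferInstanceAs (IsEmpty Empty)
    have : IsEmpty ((colLang Q).Relations 0) := ⟨fun r => by cases r⟩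
    obtain ⟨f, -⟩ := embedding_from_cg Structure.cg_of_countable default
      (hM.isExtensionPair (N := N) hN)
    exact ⟨f⟩

theorem IsRich.isFraisseLimit [Countable M] (hM : IsRich Q M) :
    IsFraisseLimit (finClass Q) M :=
  ⟨hM.isUltrahomogeneous, hM.age_eq⟩

/-- Two points of the same type over a finite set are exchanged by an automorphism fixing
this set. -/
theorem IsRich.exists_equiv [Countable M] (hM : IsRich Q M) {S : Set M} (hS : S.Finite) {m m' : M}
    (hlt : ∀ a ∈ S, Lt (Q := Q) a m ↔ Lt (Q := Q) a m')
    (hcol : ∀ a ∈ S, ∃ q : Q, Col q a m ∧ Col q a m') :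
    ∃ α : M ≃[colLang Q] M, (∀ a ∈ S, α a = a) ∧ α m = m' := by
  classical
  have hTF := hM.isTriangleFree
  have hm : m ∉ S := fun h => by
    obtain ⟨q, hq, -⟩ := hcol m h
    exact hTF.col_ne _ _ _ hq rfl
  have hne : ∀ a ∈ S, a ≠ m ∧ a ≠ m' := fun a ha => by
    obtain ⟨q, hq, hq'⟩ := hcol a ha
    exact ⟨hTF.col_ne _ _ _ hq, hTF.col_ne _ _ _ hq'⟩
  let T := Substructure.closure (colLang Q) (insert m S)
  have hT : ∀ v : T, v.1 = m ∨ v.1 ∈ S := fun v =>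
    (Substructure.mem_closure_iff_of_isRelational (colLang Q) (insert m S) v.1).1 v.2
  let G : T → M := fun v => if v.1 = m then m' else v.1
  have hGm : ∀ v : T, v.1 = m → G v = m' := fun v h => if_pos h
  have hGS : ∀ v : T, v.1 ∈ S → G v = v.1 := fun v h => if_neg fun (he : v.1 = m) => hm (he ▸ h)
  have hTS := hTF.of_embedding T.subtype
  obtain ⟨α, hα⟩ := hM.isUltrahomogeneous T (Substructure.fg_closure (hS.insert m))
    (mkEmbedding hTS hTF G
      (by
        intro v w hvw
        replace hvw : Lt (Q := Q) v.1 w.1 := (lt_embedding_iff T.subtype v w).2 hvw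
        rcases hT v with hv | hv <;> rcases hT w with hw | hw
        · exact absurd hvw (by rw [hv, hw]; exact hTF.lt_irrefl m)
        · rw [hGm v hv, hGS w hw]
          rw [hv] at hvw
          exact (hTF.lt_or_lt (hne _ hw).2).resolve_left
            fun h => hTF.lt_asymm hvw ((hlt _ hw).2 h)
        · rw [hGm w hw, hGS v hv]
          rw [hw] at hvw
          exact (hlt _ hv).1 hvw
        · rwa [hGS v hv, hGS w hw])
      (by
        intro q v w hvw
        replace hvw : Col q v.1 w.1 := (col_embedding_iff T.subtype q v w).2 hvw
        rcases hT v with hv | hv <;> rcases hT w with hw | hw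
        · exact absurd (hv.trans hw.symm) (hTF.col_ne _ _ _ hvw)
        · rw [hGm v hv, hGS w hw]
          rw [hv] at hvw
          obtain ⟨r, hr, hr'⟩ := hcol _ hw
          rw [hTF.col_unique hvw (hTF.col_symm _ _ _ hr)]
          exact hTF.col_symm _ _ _ hr'
        · rw [hGm w hw, hGS v hv]
          rw [hw] at hvw
          obtain ⟨r, hr, hr'⟩ := hcol _ hv
          rwa [hTF.col_unique hvw hr]
        · rwa [hGS v hv, hGS w hw]))
  have hα' : ∀ v : T, α v.1 = G v := fun v => (DFunLike.congr_fun hα v).symm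
  refine ⟨α, fun a ha => ?_, ?_⟩
  · have := hα' ⟨a, Substructure.subset_closure (Set.mem_insert_of_mem _ ha)⟩
    rwa [hGS _ ha] at this
  · have := hα' ⟨m, Substructure.subset_closure (Set.mem_insert _ _)⟩
    rwa [hGm _ rfl] at this

end

end Rich

/-! ### Homogeneous one-point extensions and pairs of embeddings -/

section Negative

variable {Q : Type}

section

variable {M : Type} [(colLang Q).Structure M] [Countable M]

/-- A one-point type over a rich structure is not invariant under the automorphisms fixing a finite
set `S`. Otherwise let `m` have the prescribed type over `S`, and let `m'` have the same type
over `S` and be joined to `m` by the colour prescribed at `m`. By invariance, this is also the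
colour prescribed at `m'`. -/
theorem IsRich.not_invariant (hM : IsRich Q M) {S : Set M} (hS : S.Finite) (χ : M → Q)
    (hχ : ∀ a b, ¬ (χ a = χ b ∧ Col (χ a) a b)) :
    ¬ ∀ α : M ≃[colLang Q] M, (∀ a ∈ S, α a = a) → ∀ m, χ (α m) = χ m := by
  intro hinv
  obtain ⟨m, hm⟩ := hM.realize S hS (fun _ => True) χ (fun _ _ _ _ _ _ => trivial)
    fun a _ b _ => hχ a b
  obtain ⟨m', hm'⟩ := hM.realize (insert m S) (hS.insert m) (fun _ => True) χ
    (fun _ _ _ _ _ _ => trivial) fun a _ b _ => hχ a b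
  obtain ⟨α, hα, hαm⟩ := hM.exists_equiv hS (m := m) (m' := m')
    (fun a ha => (hm a ha).1.trans (hm' a (Set.mem_insert_of_mem _ ha)).1.symm)
    fun a ha => ⟨χ a, (hm a ha).2, (hm' a (Set.mem_insert_of_mem _ ha)).2⟩
  have h := hinv α hα m
  rw [hαm] at h
  exact hχ m m' ⟨h.symm, (hm' m (Set.mem_insert _ _)).2⟩

/-- In a rich structure, a point outside a finite set `S` is moved by an automorphism
fixing `S`. -/
theorem IsRich.exists_equiv_ne [Infinite Q] (hM : IsRich Q M) {S : Set M} (hS : S.Finite) {m : M}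
    (hm : m ∉ S) : ∃ α : M ≃[colLang Q] M, (∀ a ∈ S, α a = a) ∧ α m ≠ m := by
  classical
  have hTF := hM.isTriangleFree
  have hcol : ∀ a, ∃ q : Q, a ≠ m → Col q a m := fun a => by
    by_cases h : a = m
    · exact ⟨Classical.arbitrary Q, fun h' => absurd h h'⟩
    · obtain ⟨q, hq, -⟩ := hTF.col_existsUnique a m h
      exact ⟨q, fun _ => hq⟩
  choose k hk using hcol
  obtain ⟨r, hr⟩ := (hS.image k).exists_notMem
  have hne : ∀ a ∈ S, a ≠ m := fun a ha h => hm (h ▸ ha)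
  have hr' : ∀ a ∈ S, r ≠ k a := fun a ha h => hr ⟨a, ha, h.symm⟩
  let g : M → Q := Function.update k m r
  have hgm : g m = r := Function.update_self ..
  have hg : ∀ a ∈ S, g a = k a := fun a ha => Function.update_of_ne (hne a ha) ..
  obtain ⟨t, ht⟩ := hM.realize (insert m S) (hS.insert m) (fun a => Lt (Q := Q) a m) g
    (fun a _ b _ hab hb => hTF.lt_trans hab hb)
    (by
      rintro a (rfl | ha) b (rfl | hb) ⟨h, h'⟩
      · exact hTF.col_ne _ _ _ h' rfl
      · exact hr' b hb (by rw [← hgm, h, hg b hb])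
      · exact hr' a ha (by rw [← hgm, ← h, hg a ha])
      · rw [hg a ha] at h h'
        rw [hg b hb] at h
        exact hTF.no_triangle (k a) a b m ⟨h', h ▸ hk b (hne b hb), hk a (hne a ha)⟩)
  obtain ⟨α, hα, hαm⟩ := hM.exists_equiv hS (m := m) (m' := t)
    (fun a ha => (ht a (Set.mem_insert_of_mem _ ha)).1.symm)
    fun a ha => ⟨k a, hk a (hne a ha), hg a ha ▸ (ht a (Set.mem_insert_of_mem _ ha)).2⟩
  refine ⟨α, hα, fun h => ?_⟩
  rw [hαm] at h
  exact hTF.col_ne _ _ _ (ht m (Set.mem_insert _ _)).2 h.symm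

end

/-- If the extending point lies in the image of `M`, it is moved by an automorphism fixing `x`;
otherwise its colours form a one-point type over `M` invariant under these automorphisms. -/
theorem IsRich.not_hasHomogeneousOnePointExtension [Infinite Q]
    {M : Bundled.{0} (colLang Q).Structure} [Countable M] (hM : IsRich Q M) :
    ¬ HasHomogeneousOnePointExtension (finClass Q) M := by
  rintro ⟨x, y, C, i, t, e₁, f, e₂, hx, -, hC, ht, -, -, hcomm, hext⟩
  have hCTF := (sigma_finClass_iff.1 hC).2
  have := hx.1
  have hS : (Set.range (emb e₁)).Finite := Set.finite_range _
  have hfix : ∀ α : M ≃[colLang Q] M, (∀ a ∈ Set.range (emb e₁), α a = a) →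
      ∃ β : Aut C, emb β.hom (emb e₂ t) = emb e₂ t ∧
        ∀ m, emb β.hom (emb f m) = emb f (α m) := by
    intro α hα
    obtain ⟨β, h₁, h₂⟩ := hext (isoOfEquiv α) (hom_ext_apply fun b => hα _ ⟨b, rfl⟩)
    exact ⟨β, emb_congr h₁ t, fun m => emb_congr h₂ m⟩
  by_cases hf : ∃ m, emb f m = emb e₂ t
  · obtain ⟨m, hm⟩ := hf
    have hmS : m ∉ Set.range (emb e₁) := by
      rintro ⟨b, rfl⟩
      exact ht ⟨b, emb_injective e₂ ((emb_congr hcomm b).trans hm)⟩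
    obtain ⟨α, hα, hne⟩ := hM.exists_equiv_ne hS hmS
    obtain ⟨β, h₁, h₂⟩ := hfix α hα
    exact hne (emb_injective f (by rw [← h₂, hm, h₁]))
  · have hcol : ∀ m, ∃ q, Col q (emb f m) (emb e₂ t) := fun m =>
      (hCTF.col_existsUnique _ _ fun h => hf ⟨m, h⟩).exists
    choose χ hχ using hcol
    refine hM.not_invariant hS χ ?_ ?_
    · rintro a b ⟨h, h'⟩
      exact hCTF.no_triangle (χ a) (emb f a) (emb f b) (emb e₂ t)
        ⟨(col_embedding_iff (emb f) _ _ _).2 h', h ▸ hχ b, hχ a⟩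
    · intro α hα m
      obtain ⟨β, h₁, h₂⟩ := hfix α hα
      have h := (col_embedding_iff (emb β.hom) _ _ _).2 (hχ m)
      rw [h₁, h₂] at h
      exact hCTF.col_unique (hχ _) h

/-- If the finite partial automorphisms of a countable structure can be extended to any further
point, then some automorphism meets countably many prescribed cofinal sets of finite
partial automorphisms. -/
theorem exists_equiv_meeting {L : FirstOrder.Language.{0, 0}} {M : Type} [L.Structure M]
    [Countable M] (hM : L.IsExtensionPair M M) {ι : Type} [Countable ι]
    (D : ι → Order.Cofinal (L.FGEquiv M M)) :
    ∃ f : M ≃[L] M, ∀ i, ∃ g ∈ D i, g.1 ≤ f.toEmbedding.toPartialEquiv := by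
  let _ : Encodable ((M ⊕ M) ⊕ ι) := Encodable.ofCountable _
  let D' : (M ⊕ M) ⊕ ι → Order.Cofinal (L.FGEquiv M M) :=
    Sum.elim (Sum.elim hM.definedAtLeft hM.definedAtRight) D
  let s := Order.sequenceOfCofinals default D'
  let S : ℕ →o M ≃ₚ[L] M := ⟨Subtype.val ∘ s,
    (Subtype.mono_coe _).comp (Order.sequenceOfCofinals.monotone _ _)⟩
  let F := DirectLimit.partialEquivLimit S
  have hs : ∀ k, ∃ n, s n ∈ D' k := fun k => ⟨_, Order.sequenceOfCofinals.encode_mem default D' k⟩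
  have hF : ∀ n, (s n).1 ≤ F := DirectLimit.le_partialEquivLimit S
  have hdom : F.dom = ⊤ := top_le_iff.1 fun m _ => by
    obtain ⟨n, hn⟩ := hs (Sum.inl (Sum.inl m))
    exact PartialEquiv.dom_le_dom (hF n) hn
  have hcod : F.cod = ⊤ := top_le_iff.1 fun m _ => by
    obtain ⟨n, hn⟩ := hs (Sum.inl (Sum.inr m))
    exact PartialEquiv.cod_le_cod (hF n) hn
  refine ⟨PartialEquiv.toEquivOfEqTop hdom hcod, fun i => ?_⟩
  obtain ⟨n, hn⟩ := hs (Sum.inr i)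
  refine ⟨s n, hn, ?_⟩
  rw [PartialEquiv.toEquivOfEqTop_toEmbedding, Embedding.toPartialEquiv_toEmbedding]
  exact hF n

/-- The types over `e : M ⟶ M` realized in `M` are countably many, and the type `χ t` of a point
`t` outside the range of `e` is moved among them by the automorphisms of `M`. If the type `χ t` were
not invariant under the pointwise stabilizer of any finite set, then an automorphism moving `χ t` to
none of the countably many types `χ s` could be constructed from finite
partial automorphisms. -/
theorem IsRich.not_hasNontrivialPair [Nonempty Q]
    {M : Bundled.{0} (colLang Q).Structure} [Countable M] (hM : IsRich Q M) :
    ¬ HasNontrivialPair M := by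
  rintro ⟨e, E, hsurj, -, hE⟩
  rw [Function.Surjective, not_forall] at hsurj
  obtain ⟨t, ht⟩ := hsurj
  have hTF := hM.isTriangleFree
  have hcol : ∀ s m : M, ∃ q : Q, emb e m ≠ s → Col q (emb e m) s := fun s m => by
    by_cases h : emb e m = s
    · exact ⟨Classical.arbitrary Q, fun h' => absurd h h'⟩
    · obtain ⟨q, hq, -⟩ := hTF.col_existsUnique _ _ h
      exact ⟨q, fun _ => hq⟩
  choose χ hχ using hcol
  have hχt : ∀ m, Col (χ t m) (emb e m) t := fun m => hχ t m fun h => ht ⟨m, h⟩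
  -- The type of `E α t` is the image under `α` of the type of `t`.
  have horb : ∀ α : M ≃[colLang Q] M, ∃ s, ∀ m, χ s (α m) = χ t m := by
    intro α
    have hα : ∀ m, emb (E (isoOfEquiv α)).hom (emb e m) = emb e (α m) := fun m =>
      emb_congr (hE (isoOfEquiv α)) m
    refine ⟨emb (E (isoOfEquiv α)).hom t, fun m => ?_⟩
    have h := (col_embedding_iff (emb (E (isoOfEquiv α)).hom) _ _ _).2 (hχt m)
    rw [hα] at h
    exact hTF.col_unique (hχ _ _ (hTF.col_ne _ _ _ h)) h
  by_cases hcof : ∀ s : M, IsCofinal {p : (colLang Q).FGEquiv M M |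
      ∃ m : p.1.dom, χ t m ≠ χ s (p.1.toEquiv m)}
  · obtain ⟨α, hα⟩ := exists_equiv_meeting (hM.isExtensionPair hTF) fun s => ⟨_, hcof s⟩
    obtain ⟨s, hs⟩ := horb α
    obtain ⟨p, ⟨m, hm⟩, hp⟩ := hα s
    obtain ⟨hdom, heq⟩ := (PartialEquiv.le_def _ _).1 hp
    have h : α m = p.1.toEquiv m := DFunLike.congr_fun heq m
    exact hm (by rw [← hs m, h])
  · simp only [IsCofinal, not_forall, not_exists, not_and, Set.mem_ofPred_eq] at hcof
    obtain ⟨s, p, hp⟩ := hcof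
    -- No extension of `p` moves `χ t` away from `χ s`, so all automorphisms extending `p` move
    -- `χ t` to `χ s`, and any two of them differ by an automorphism fixing `χ t`.
    have hconst : ∀ α : M ≃[colLang Q] M, (∀ a : p.1.dom, α a = p.1.toEquiv a) →
        ∀ m, χ s (α m) = χ t m := by
      intro α hα m
      have hle : p.1 ≤ α.toEmbedding.toPartialEquiv :=
        (PartialEquiv.le_def _ _).2 ⟨le_top, Embedding.ext hα⟩
      let T := Substructure.closure (colLang Q) {m} ⊔ p.1.dom
      let p' : (colLang Q).FGEquiv M M :=
        ⟨α.toEmbedding.toPartialEquiv.domRestrict (A := T) le_top,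
          (Substructure.fg_closure_singleton m).sup p.2⟩
      have hmT : m ∈ T := (le_sup_left : _ ≤ T) (Substructure.subset_closure rfl)
      by_contra hne
      exact hp p' ⟨⟨m, hmT⟩, fun h => hne h.symm⟩
        (PartialEquiv.le_domRestrict _ _ le_sup_right le_top hle)
    obtain ⟨α, hα⟩ := hM.isUltrahomogeneous p.1.dom p.2 p.1.toEmbedding
    have hα' : ∀ a : p.1.dom, α a = p.1.toEquiv a := fun a => (DFunLike.congr_fun hα a).symm
    have := p.2.finite
    refine hM.not_invariant (S := (p.1.dom : Set M)) (Set.toFinite _) (χ t) ?_ ?_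
    · rintro a b ⟨h, h'⟩
      exact hTF.no_triangle (χ t a) (emb e a) (emb e b) t
        ⟨(col_embedding_iff (emb e) _ _ _).2 h', h ▸ hχt b, hχt a⟩
    · intro β hβ m
      have hαβ : ∀ a : p.1.dom, α.comp β a = p.1.toEquiv a := fun a => by
        rw [Language.Equiv.comp_apply, hβ _ a.2, hα']
      rw [← hconst α hα', ← hconst _ hαβ, Language.Equiv.comp_apply]

/-! ### Absence of a Katětov functor -/

/-- The colouring of at most two points with the single colour `q`. -/
def constColouring (q : Q) {n : ℕ} (hn : n ≤ 2) : Colouring Q (Fin n) where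
  col _ _ := q
  col_comm _ _ := rfl
  no_triangle a b c hab hbc hac := by omega

/-- At most two points with the single colour `q`. -/
def constObj (q : Q) {n : ℕ} (hn : n ≤ 2) : (classOf (finClass Q)).FullSubcategory :=
  ⟨⟨Fin n, (constColouring q hn).toStructure⟩,
    inferInstanceAs (Finite (Fin n)), (constColouring q hn).isTriangleFree⟩

/-- The point `u` added to the empty structure induces a point over every finite structure, and both
embeddings of a one-point structure into a pair of points send it to the same place. So both points
of the pair are joined to it by a colour `q` which does not depend on the pair; this is impossible
for a pair of colour `q`. -/
theorem not_hasKatetovFunctor [Nonempty Q] : ¬ HasKatetovFunctor (finClass Q) := by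
  rintro ⟨F, η, h⟩
  let r : Q := Classical.arbitrary Q
  let x : (classOf (finClass Q)).FullSubcategory := constObj r (n := 0) (by omega)
  let y : (classOf (finClass Q)).FullSubcategory := constObj r (n := 1) (by omega)
  let i : x ⟶ y := ObjectProperty.homMk (mkEmbedding x.property.2 y.property.2
    (fun a : Fin 0 => a.elim0) (fun a : Fin 0 => a.elim0) fun _ (a : Fin 0) => a.elim0)
  obtain ⟨g, -⟩ := h x y i.hom ⟨(0 : Fin 1), by
    refine top_le_iff.1 fun v _ => Substructure.subset_closure (Or.inl ?_)
    exact Subsingleton.elim (α := Fin 1) _ _⟩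
  let u : (F.obj x).obj := emb g (0 : Fin 1)
  let v : (F.obj y).obj := emb (F.map i).hom u
  let p : y.obj := (0 : Fin 1)
  -- The two embeddings of a point into a pair agree on the empty structure.
  have hpair : ∀ q : Q, ∃ (z : (classOf (finClass Q)).FullSubcategory) (j₁ j₂ : y ⟶ z),
      Col q (emb j₁.hom p) (emb j₂.hom p) ∧
        emb (F.map j₁).hom v = emb (F.map j₂).hom v := by
    intro q
    let z : (classOf (finClass Q)).FullSubcategory := constObj q (n := 2) le_rfl
    let j : Fin 2 → (y ⟶ z) := fun k => ObjectProperty.homMk (mkEmbedding y.property.2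
      z.property.2
      (fun _ : Fin 1 => k)
      (fun (a b : Fin 1) hab => absurd hab (by
        rw [Subsingleton.elim a b]; exact y.property.2.lt_irrefl _))
      (fun q (a b : Fin 1) hab => absurd (Subsingleton.elim a b) (y.property.2.col_ne q _ _ hab)))
    refine ⟨z, j 0, j 1, ⟨Fin.zero_ne_one, rfl⟩, ?_⟩
    have hij : i ≫ j 0 = i ≫ j 1 :=
      ObjectProperty.hom_ext _ (hom_ext_apply fun a : Fin 0 => a.elim0)
    have hF := congrArg (fun k => emb (F.map k).hom u) hij
    simp only [F.map_comp] at hF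
    exact hF
  have hnat : ∀ {z : (classOf (finClass Q)).FullSubcategory} (j : y ⟶ z),
      emb (F.map j).hom (emb (η.app y) p) = emb (η.app z) (emb j.hom p) := fun j =>
    (emb_congr (η.naturality j) p).symm
  have hTF : ∀ z, IsTriangleFree Q (F.obj z).obj := fun z =>
    (sigma_finClass_iff.1 (F.obj z).property).2
  by_cases hv : emb (η.app y) p = v
  · obtain ⟨z, j₁, j₂, hq, hj⟩ := hpair r
    rw [← hv, hnat, hnat] at hj
    exact z.property.2.col_ne _ _ _ hq (emb_injective (η.app z) hj)
  · obtain ⟨q, hq, -⟩ := (hTF y).col_existsUnique _ _ hv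
    obtain ⟨z, j₁, j₂, hj, hjv⟩ := hpair q
    have h₁ := (col_embedding_iff (emb (F.map j₁).hom) _ _ _).2 hq
    have h₂ := (col_embedding_iff (emb (F.map j₂).hom) _ _ _).2 hq
    have h₃ := (col_embedding_iff (emb (η.app z)) _ _ _).2 hj
    rw [hnat] at h₁ h₂
    rw [← hjv] at h₂
    exact (hTF z).no_triangle q _ _ _ ⟨h₃, h₂, h₁⟩

end Negative

/-! ### Colimits of chains of functors -/

section Chain

variable {L : FirstOrder.Language.{0, 0}} {C : Type*} [Category C]

theorem natLERec_compatible {G : ℕ → Type} [∀ n, L.Structure (G n)] {P : Type} [L.Structure P]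
    (f : ∀ n, G n ↪[L] G (n + 1)) (g : ∀ n, G n ↪[L] P) (h : ∀ n x, g (n + 1) (f n x) = g n x)
    (m n : ℕ) (hmn : m ≤ n) (x : G m) : g n (DirectedSystem.natLERec f m n hmn x) = g m x := by
  rw [DirectedSystem.coe_natLERec]
  dsimp only
  induction n, hmn using Nat.le_induction with
  | base => rw [Nat.leRecOn_self]
  | succ n hmn ih => rw [Nat.leRecOn_succ hmn, h, ih]

/-- A chain of functors to the category of structures has a pointwise colimit. -/
theorem exists_colimit_of_chain (G : ℕ → C ⥤ Bundled.{0} L.Structure)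
    (τ : ∀ n, G n ⟶ G (n + 1)) :
    ∃ (F : C ⥤ Bundled.{0} L.Structure) (μ : ∀ n, G n ⟶ F),
      (∀ n X, (τ n).app X ≫ (μ (n + 1)).app X = (μ n).app X) ∧
      ∀ (X : C) (m : F.obj X), ∃ n, ∃ a : (G n).obj X, emb ((μ n).app X) a = m := by
  let f : ∀ X n, (G n).obj X ↪[L] (G (n + 1)).obj X := fun X n => emb ((τ n).app X)
  let lim : C → Bundled.{0} L.Structure := fun X =>
    ⟨Language.DirectLimit (fun n => (G n).obj X) (DirectedSystem.natLERec (f X)), inferInstance⟩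
  let inc : ∀ n X, (G n).obj X ↪[L] lim X := fun n X =>
    DirectLimit.of L ℕ (fun n => (G n).obj X) (DirectedSystem.natLERec (f X)) n
  have hinc : ∀ n X x, inc (n + 1) X (f X n x) = inc n X x := fun n X x => by
    have h := DirectLimit.of_f (L := L) (G := fun n => (G n).obj X)
      (f := DirectedSystem.natLERec (f X)) (hij := Nat.le_succ n) (x := x)
    rw [DirectedSystem.coe_natLERec] at h
    dsimp only at h
    rw [Nat.leRecOn_succ'] at h
    exact h
  have hstep : ∀ {X Y : C} (e : X ⟶ Y) n x,
      inc (n + 1) Y (emb ((G (n + 1)).map e) (f X n x)) = inc n Y (emb ((G n).map e) x) := by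
    intro X Y e n x
    exact (congrArg (inc (n + 1) Y) (emb_congr ((τ n).naturality e) x).symm).trans (hinc n Y _)
  let map : ∀ {X Y : C}, (X ⟶ Y) → (lim X ↪[L] lim Y) := fun {X Y} e =>
    Language.DirectLimit.lift L ℕ (fun n => (G n).obj X) (DirectedSystem.natLERec (f X))
      (fun n => (inc n Y).comp (emb ((G n).map e)))
      (natLERec_compatible (f X) _ fun n x => hstep e n x)
  have hmap : ∀ {X Y : C} (e : X ⟶ Y) n x, map e (inc n X x) = inc n Y (emb ((G n).map e) x) :=
    fun {X Y} e n x => Language.DirectLimit.lift_of ..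
  have hsurj : ∀ X (m : lim X), ∃ n a, inc n X a = m := fun X m => DirectLimit.exists_of m
  refine ⟨
    { obj := lim
      map := map
      map_id := fun X => hom_ext_apply fun m => by
        obtain ⟨n, a, rfl⟩ := hsurj X m
        refine (hmap _ n a).trans ?_
        rw [(G n).map_id]
        rfl
      map_comp := fun {X Y Z} e e' => hom_ext_apply fun m => by
        obtain ⟨n, a, rfl⟩ := hsurj X m
        refine (hmap _ n a).trans ?_
        rw [(G n).map_comp, emb_comp, ← hmap, ← hmap]
        rfl },
    fun n => { app := inc n, naturality := fun X Y e => hom_ext_apply fun a => (hmap e n a).symm },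
    fun n X => hom_ext_apply fun a => hinc n X a, hsurj⟩

end Chain

/-! ### The `ω`-fold composition -/

section Omega

variable {Q : Type}

/-- A functor `Kω` which is an `ω`-fold composition is faithful, because `X ⟶ Kω X` is natural
and injective. -/
theorem IsOmegaComposition.faithful {A : ℕ → Set Q}
    {K : ∀ i, SigmaIn (A i) ⥤ SigmaIn (A (i + 1))}
    {ν : ∀ i, (sigma (finClassIn (A i))).ι ⟶ K i ⋙ (sigma (finClassIn (A (i + 1)))).ι}
    {F : SigmaIn (A 0) ⥤ Bundled.{0} (colLang Q).Structure}
    (h : IsOmegaComposition A K ν F) : F.Faithful where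
  map_injective {X Y f g} hfg := by
    obtain ⟨μ, -, -⟩ := h
    refine ObjectProperty.hom_ext _ (hom_ext_apply fun x => emb_injective ((μ 0).app Y) ?_)
    have hf := emb_congr ((μ 0).naturality f) x
    have hg := emb_congr ((μ 0).naturality g) x
    rw [hfg] at hf
    exact hf.trans hg.symm

/-- Being an `ω`-fold composition is invariant under natural isomorphism. -/
theorem IsOmegaComposition.of_iso {A : ℕ → Set Q}
    {K : ∀ i, SigmaIn (A i) ⥤ SigmaIn (A (i + 1))}
    {ν : ∀ i, (sigma (finClassIn (A i))).ι ⟶ K i ⋙ (sigma (finClassIn (A (i + 1)))).ι}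
    {F F' : SigmaIn (A 0) ⥤ Bundled.{0} (colLang Q).Structure}
    (h : IsOmegaComposition A K ν F) (w : F ≅ F') : IsOmegaComposition A K ν F' := by
  obtain ⟨μ, h₁, h₂⟩ := h
  refine ⟨fun n => μ n ≫ w.hom, fun n X => ?_, fun X m => ?_⟩
  · exact congrArg (· ≫ w.hom.app X) (h₁ n X)
  · obtain ⟨n, a, ha⟩ := h₂ X (emb (w.inv.app X) m)
    refine ⟨n, a, ?_⟩
    rw [NatTrans.comp_app, emb_comp, ha]
    exact emb_congr (w.inv_hom_id_app X) m

/-- The `ω`-fold composition of the functors adding one point per partial type exists, and takes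
rich values: a type over a finite subset of the colimit, with its finitely many colours, is
a partial type at some stage, and is realized at the next one. -/
theorem exists_isOmegaComposition [Countable Q] [Infinite Q] (A : ℕ → Set Q)
    (hA : ∀ i, A i ⊆ A (i + 1)) (hinf : ∀ i, (A (i + 1) \ A i).Infinite)
    (hU : (⋃ i, A i) = Set.univ) :
    ∃ (K : ∀ i, SigmaIn (A i) ⥤ SigmaIn (A (i + 1)))
      (ν : ∀ i, (sigma (finClassIn (A i))).ι ⟶ K i ⋙ (sigma (finClassIn (A (i + 1)))).ι)
      (F : SigmaIn (A 0) ⥤ Bundled.{0} (colLang Q).Structure),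
      (∀ i, AddsOnePointPerType (A i) (A (i + 1)) (K i) (ν i)) ∧ IsOmegaComposition A K ν F ∧
      ∀ X, Countable (F.obj X) ∧ IsRich Q (F.obj X) := by
  obtain ⟨enc, henc⟩ := exists_injective_nat Q
  let _ : LinearOrder Q := LinearOrder.lift' enc henc
  let _ : Inhabited Q := ⟨Classical.arbitrary Q⟩
  let κ : ∀ i, FreshCode (A i) (A (i + 1)) := fun i => (FreshCode.nonempty (hinf i)).some
  let K : ∀ i, SigmaIn (A i) ⥤ SigmaIn (A (i + 1)) := fun i => extFunctor (κ i) (hA i)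
  let ν : ∀ i, (sigma (finClassIn (A i))).ι ⟶ K i ⋙ (sigma (finClassIn (A (i + 1)))).ι :=
    fun i => extNatTrans (κ i) (hA i)
  obtain ⟨F, μ, hμ, hsurj⟩ := exists_colimit_of_chain
    (fun n => iterComp A K n ⋙ (sigma (finClassIn (A n))).ι)
    fun n => Functor.whiskerLeft (iterComp A K n) (ν n)
  refine ⟨K, ν, F, fun i => addsOnePointPerType_extFunctor (κ i) (hA i), ⟨μ, hμ, hsurj⟩,
    fun X => ?_⟩
  let Y : ∀ n, SigmaIn (A n) := fun n => (iterComp A K n).obj X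
  have hY : ∀ n, Countable (Y n).obj ∧ IsTriangleFree Q (Y n).obj := fun n =>
    (sigma_finClassIn_iff.1 (Y n).property).imp_right And.left
  have hcomm : ∀ n, (ν n).app (Y n) ≫ (μ (n + 1)).app X = (μ n).app X := fun n => hμ n X
  have hF := isTriangleFree_of_chain hY hcomm (hsurj X)
  refine ⟨hF.1, hF.2, fun S hS D g hD hg => ?_⟩
  obtain ⟨n₀, hn₀⟩ := exists_range_of_chain hcomm (hsurj X) hS
  obtain ⟨n₁, hn₁⟩ : ∃ n₁, g '' S ⊆ A n₁ := by
    have hdir : Directed (· ⊆ ·) A := (monotone_nat_of_le_succ hA).directed_le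
    exact hdir.exists_mem_subset_of_finset_subset_biUnion (s := (hS.image g).toFinset)
      (by simp [hU]) |>.imp fun _ h => by simpa using h
  let n := max n₀ n₁
  have hgA : ∀ a ∈ S, g a ∈ A n := fun a ha =>
    monotone_nat_of_le_succ hA (le_max_right n₀ n₁) (hn₁ ⟨a, ha, rfl⟩)
  let j : (Y n).obj ⟶ F.obj X := (μ n).app X
  obtain ⟨t, ht⟩ := extObj_realize (κ n) (Y n) (emb j ⁻¹' S)
    (hS.preimage (emb_injective j).injOn) (fun a => D (emb j a)) (fun a => g (emb j a))
    (fun a ha b hb hab => hD _ ha _ hb ((lt_embedding_iff (emb j) a b).2 hab))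
    (fun a ha => hgA _ ha)
    (fun a ha b hb h => hg _ ha _ hb ⟨h.1, (col_embedding_iff (emb j) _ a b).2 h.2⟩)
  let j' : extObj (κ n) (Y n) ⟶ F.obj X := (μ (n + 1)).app X
  refine ⟨emb j' t, fun a ha => ?_⟩
  obtain ⟨a, rfl⟩ := hn₀ n (le_max_left _ _) ha
  have hja : emb j a = emb j' (emb (extUnit (κ n) (Y n)) a) := (emb_congr (hcomm n) a).symm
  have h := ht a ha
  constructor
  · rw [← h.1, ← lt_embedding_iff (emb j'), ← hja]
  · have h' := (col_embedding_iff (emb j') _ _ _).2 h.2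
    rwa [← hja] at h'

/-- The colours can be exhausted by a chain as in the `ω`-fold composition. -/
theorem exists_chain_of_colours [Countable Q] [Infinite Q] :
    ∃ (A : ℕ → Set Q) (ρ : Q → Q), Function.Injective ρ ∧ Set.range ρ = A 0 ∧
      (∀ i, A i ⊆ A (i + 1)) ∧ (∀ i, (A (i + 1) \ A i).Infinite) ∧ (⋃ i, A i) = Set.univ := by
  obtain ⟨d⟩ : Nonempty (Q ≃ ℕ) := nonempty_equiv_of_countable
  let e : Q ≃ ℕ × ℕ := d.trans Nat.pairEquiv.symm
  refine ⟨fun i => {q | (e q).1 ≤ i}, fun q => e.symm (0, d q), ?_, ?_, ?_, ?_, ?_⟩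
  · intro q r h
    simpa using h
  · ext q
    simp only [Set.mem_range, Set.mem_ofPred_eq, Nat.le_zero]
    constructor
    · rintro ⟨r, rfl⟩
      simp
    · intro h
      exact ⟨d.symm (e q).2, by rw [Equiv.apply_symm_apply, ← h, Prod.mk.eta, e.symm_apply_apply]⟩
  · exact fun i q hq => Nat.le_succ_of_le hq
  · intro i
    refine Set.infinite_of_injective_forall_mem (f := fun k : ℕ => e.symm (i + 1, k)) ?_ ?_
    · intro k l h
      simpa using h
    · intro k
      simp
  · refine Set.eq_univ_of_forall fun q => Set.mem_iUnion.2 ⟨(e q).1, le_refl (e q).1⟩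

theorem exists_isRich [Countable Q] [Infinite Q] :
    ∃ M : Bundled.{0} (colLang Q).Structure, Countable M ∧ IsRich Q M := by
  obtain ⟨A, -, -, -, hA, hinf, hU⟩ := exists_chain_of_colours (Q := Q)
  obtain ⟨-, -, F, -, -, hF⟩ := exists_isOmegaComposition A hA hinf hU
  have h : sigma (finClassIn (A 0)) (constObj (Classical.arbitrary Q) (Nat.zero_le 2)).obj :=
    sigma_finClassIn_iff.2 ⟨inferInstanceAs (Countable (Fin 0)),
      (constObj _ (Nat.zero_le 2)).property.2, fun _ (a : Fin 0) => a.elim0⟩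
  exact ⟨_, hF ⟨_, h⟩⟩

/-- All Fraïssé limits are isomorphic, and one of them is rich. -/
theorem isRich_of_isFraisseLimit [Countable Q] [Infinite Q]
    {M : Bundled.{0} (colLang Q).Structure} [Countable M] (hM : IsFraisseLimit (finClass Q) M) :
    IsRich Q M := by
  obtain ⟨N, hN, hR⟩ := exists_isRich (Q := Q)
  obtain ⟨e⟩ := hR.isFraisseLimit.nonempty_equiv hM
  exact hR.of_equiv e

/-! ### Recolouring, and universality of the Fraïssé limit -/

theorem sigma_recolor {A : Set Q} {ρ : Q → Q} (hρ : Function.Injective ρ)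
    (hA : Set.range ρ = A) {X : Bundled.{0} (colLang Q).Structure} (hX : sigma (finClass Q) X) :
    sigma (finClassIn A) ((recolor ρ).obj X) := by
  obtain ⟨hc, h⟩ := sigma_finClass_iff.1 hX
  have hlt : ∀ a b : X, Lt (Q := Q) (M := (recolor ρ).obj X) a b ↔ Lt (Q := Q) a b :=
    fun _ _ => Iff.rfl
  have hcol : ∀ (q : Q) (a b : X),
      Col (M := (recolor ρ).obj X) q a b ↔ ∃ r, ρ r = q ∧ Col r a b := fun _ _ _ => Iff.rfl
  refine sigma_finClassIn_iff.2 ⟨hc, ⟨h.order, ?_, ?_, ?_, ?_⟩, ?_⟩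
  · rintro q a b ⟨r, -, hr⟩
    exact h.col_ne r a b hr
  · rintro q a b ⟨r, hrq, hr⟩
    exact ⟨r, hrq, h.col_symm r a b hr⟩
  · intro a b hab
    obtain ⟨r, hr, hu⟩ := h.col_existsUnique a b hab
    refine ⟨ρ r, ⟨r, rfl, hr⟩, ?_⟩
    rintro _ ⟨r', rfl, hr'⟩
    rw [hu r' hr']
  · rintro q a b c ⟨⟨r₁, h₁, h₁'⟩, ⟨r₂, h₂, h₂'⟩, ⟨r₃, h₃, h₃'⟩⟩
    obtain rfl := hρ (h₁.trans h₂.symm)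
    obtain rfl := hρ (h₁.trans h₃.symm)
    exact h.no_triangle r₁ a b c ⟨h₁', h₂', h₃'⟩
  · rintro q a b ⟨r, rfl, -⟩
    exact hA ▸ ⟨r, rfl⟩

instance recolor_faithful (ρ : Q → Q) : (recolor ρ).Faithful where
  map_injective h := hom_ext_apply fun x => emb_congr h x

theorem exists_functor_to_fraisseLimit [Countable Q] [Infinite Q]
    {M : Bundled.{0} (colLang Q).Structure} [Countable M] (hM : IsRich Q M)
    (A : ℕ → Set Q) (ρ : Q → Q) (hρ : Function.Injective ρ) (hρA : Set.range ρ = A 0)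
    (hA : ∀ i, A i ⊆ A (i + 1)) (hinf : ∀ i, (A (i + 1) \ A i).Infinite)
    (hU : (⋃ i, A i) = Set.univ) :
    ∃ (K : ∀ i, SigmaIn (A i) ⥤ SigmaIn (A (i + 1)))
      (ν : ∀ i, (sigma (finClassIn (A i))).ι ⟶ K i ⋙ (sigma (finClassIn (A (i + 1)))).ι)
      (Kω : SigmaIn (A 0) ⥤ (ObjectProperty.singleton M).FullSubcategory)
      (R : (sigma (finClass Q)).FullSubcategory ⥤ SigmaIn (A 0)),
      (∀ i, AddsOnePointPerType (A i) (A (i + 1)) (K i) (ν i)) ∧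
      IsOmegaComposition A K ν (Kω ⋙ (ObjectProperty.singleton M).ι) ∧
      Kω.Faithful ∧
      Nonempty (R ⋙ (sigma (finClassIn (A 0))).ι ≅ (sigma (finClass Q)).ι ⋙ recolor ρ) ∧
      (R ⋙ Kω).Faithful := by
  obtain ⟨K, ν, F, hK, hF, hFR⟩ := exists_isOmegaComposition A hA hinf hU
  have hiso : ∀ X, Nonempty (F.obj X ≃[colLang Q] M) := fun X =>
    haveI := (hFR X).1
    (hFR X).2.isFraisseLimit.nonempty_equiv hM.isFraisseLimit
  -- The values of `F` are replaced by the isomorphic structure `M` itself.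
  let w : ∀ X, F.obj X ≅ M := fun X => isoOfEquiv (hiso X).some
  let Kω : SigmaIn (A 0) ⥤ (ObjectProperty.singleton M).FullSubcategory :=
    (ObjectProperty.singleton M).lift (F.copyObj (fun _ => M) w) fun _ => by simp
  let R : (sigma (finClass Q)).FullSubcategory ⥤ SigmaIn (A 0) :=
    (sigma (finClassIn (A 0))).lift ((sigma (finClass Q)).ι ⋙ recolor ρ)
      fun X => sigma_recolor hρ hρA X.property
  have hω : IsOmegaComposition A K ν (Kω ⋙ (ObjectProperty.singleton M).ι) :=
    hF.of_iso (F.isoCopyObj (fun _ => M) w)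
  have hf : Kω.Faithful := by
    have := hω.faithful
    exact Functor.Faithful.of_comp Kω (ObjectProperty.singleton M).ι
  have hR : R.Faithful := inferInstance
  exact ⟨K, ν, Kω, R, hK, hω, hf, ⟨Iso.refl _⟩, inferInstance⟩

/-- A faithful functor induces embeddings of automorphism groups and endomorphism monoids. -/
theorem exists_injective_monoidHom {C D : Type*} [Category C] [Category D] {P : ObjectProperty C}
    {P' : ObjectProperty D} (F : P.FullSubcategory ⥤ P'.FullSubcategory) [F.Faithful] {X : C}
    (hX : P X) {M : D} (w : (F.obj ⟨X, hX⟩).obj ≅ M) :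
    (∃ φ : Aut X →* Aut M, Function.Injective φ) ∧ ∃ φ : End X →* End M, Function.Injective φ := by
  let X' : P.FullSubcategory := ⟨X, hX⟩
  let G := F ⋙ P'.ι
  constructor
  · let a : Aut X' ≃* Aut X := P.fullyFaithfulι.autMulEquivOfFullyFaithful X'
    refine ⟨w.conjAut.toMonoidHom.comp ((G.mapAut X').comp a.symm.toMonoidHom), ?_⟩
    have hG : Function.Injective (G.mapAut X') := fun f g h =>
      Iso.ext (G.map_injective (congrArg Iso.hom h))
    exact w.conjAut.injective.comp (hG.comp a.symm.injective)
  · let a : End X' ≃* End X := P.fullyFaithfulι.mulEquivEnd X'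
    refine ⟨w.conj.toMonoidHom.comp ((G.mapEnd X').comp a.symm.toMonoidHom), ?_⟩
    have hG : Function.Injective (G.mapEnd X') := fun f g h => G.map_injective h
    exact w.conj.injective.comp (hG.comp a.symm.injective)

end Omega

end FraisseNoKatetov

open FraisseNoKatetov
theorem mainTheorem1 (Q : Type) [Countable Q] [Infinite Q] :
    -- the class is a Fraïssé class, and it has a Fraïssé limit
    IsFraisse (finClass Q) ∧
    (∃ (M : Bundled.{0} (colLang Q).Structure) (_ : Countable M), IsFraisseLimit (finClass Q) M) ∧
    -- it has no Katětov functor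
    ¬ HasKatetovFunctor (finClass Q) ∧
    ∀ (M : Bundled.{0} (colLang Q).Structure) [Countable M], IsFraisseLimit (finClass Q) M →
      ¬ HasHomogeneousOnePointExtension (finClass Q) M ∧
      ¬ HasNontrivialPair M ∧
      -- a faithful functor to the full subcategory on the Fraïssé limit
      (∃ F : (sigma (finClass Q)).FullSubcategory ⥤ (ObjectProperty.singleton M).FullSubcategory,
        F.Faithful) ∧
      -- universality of the automorphism group and of the monoid of self-embeddings
      (∀ X : Bundled.{0} (colLang Q).Structure, sigma (finClass Q) X →
        (∃ φ : Aut X →* Aut M, Function.Injective φ) ∧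
        ∃ φ : End X →* End M, Function.Injective φ) ∧
      -- such a functor is, after moving all colours into `A 0`, an `ω`-fold composition
      ∀ (A : ℕ → Set Q) (ρ : Q → Q), Function.Injective ρ → Set.range ρ = A 0 →
        (∀ i, A i ⊆ A (i + 1)) → (∀ i, (A (i + 1) \ A i).Infinite) → (⋃ i, A i) = Set.univ →
        ∃ (K : ∀ i, SigmaIn (A i) ⥤ SigmaIn (A (i + 1)))
          (ν : ∀ i, (sigma (finClassIn (A i))).ι ⟶ K i ⋙ (sigma (finClassIn (A (i + 1)))).ι)
          (Kω : SigmaIn (A 0) ⥤ (ObjectProperty.singleton M).FullSubcategory)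
          (R : (sigma (finClass Q)).FullSubcategory ⥤ SigmaIn (A 0)),
          (∀ i, AddsOnePointPerType (A i) (A (i + 1)) (K i) (ν i)) ∧
          IsOmegaComposition A K ν (Kω ⋙ (ObjectProperty.singleton M).ι) ∧
          Kω.Faithful ∧
          Nonempty (R ⋙ (sigma (finClassIn (A 0))).ι ≅ (sigma (finClass Q)).ι ⋙ recolor ρ) ∧
          (R ⋙ Kω).Faithful := by
  obtain ⟨N, hN, hR⟩ := exists_isRich (Q := Q)
  refine ⟨hR.isFraisseLimit.isFraisse, ⟨N, hN, hR.isFraisseLimit⟩, not_hasKatetovFunctor, ?_⟩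
  intro M _ hlim
  have hM := isRich_of_isFraisseLimit hlim
  obtain ⟨A, ρ, hρ, hρA, hA, hinf, hU⟩ := exists_chain_of_colours (Q := Q)
  obtain ⟨-, -, Kω, R, -, -, -, -, hf⟩ :=
    exists_functor_to_fraisseLimit hM A ρ hρ hρA hA hinf hU
  refine ⟨hM.not_hasHomogeneousOnePointExtension, hM.not_hasNontrivialPair, ⟨R ⋙ Kω, hf⟩,
    fun X hX => ?_, exists_functor_to_fraisseLimit hM⟩
  exact exists_injective_monoidHom (R ⋙ Kω) hX
    (eqToIso ((ObjectProperty.singleton_iff M _).1 ((R ⋙ Kω).obj ⟨X, hX⟩).property).symm)
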